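/- Let $\mathbb{T}^d=(\mathbb{R}/2\pi\mathbb{Z})^d$ with its Lebesgue measure, and let $$\mathcal{F}_d=\{\mathbf{1}_{\Omega} : \Omega\subseteq\mathbb{T}^d \text{ open},\ \mathrm{Lebesgue}_d(\partial\Omega)=0\}.$$ Let $v=(v_1,\dots,v_d)\in\mathbb{R}^d$ be such that $v_1,\dots,v_d$ are linearly independent over $\mathbb{Q}$, and let $(X_t)_{t\ge 0}$ be Brownian motion on $\mathbb{T}^d$ with drift $v$: a $\mathbb{T}^d$-valued process with almost surely continuous paths and independent increments, such that for all $s,t\ge 0$ the increment $X_{s+t}-X_s$ is distributed as the image in $\mathbb{T}^d$ of a Gaussian vector on $\mathbb{R}^d$ with mean $tv$ and covariance matrix $t\,\mathrm{Id}$; the starting point $X_0$ is arbitrary. Then $\mathcal{F}_d$ is reconstructible by $X_t$; that is, there is a function $A:\mathbb{R}^{[0,\infty)}\to\mathbb{R}^{\mathbb{T}^d}$ such that for every $f\in\mathcal{F}_d$, with probability $1$ there exists a (random) shift $\theta\in\mathbb{T}^d$ with $$A\big((f(X_t))_{t\ge 0}\big)(x)=f(x+\theta)\qquad\text{for almost every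 } x\in\mathbb{T}^d .$$ -/

import Mathlib

open MeasureTheory ProbabilityTheory
open scoped NNReal Real

instance fact_two_pi_pos : Fact (0 < 2 * π) := ⟨Real.two_pi_pos⟩

/-- The `d`-dimensional torus `(ℝ / 2πℤ)^d`. Its `volume` is Lebesgue measure,
of total mass `(2π)^d`. -/
abbrev Torus (d : ℕ) : Type := Fin d → AddCircle (2 * π)

/-- The quotient map `ℝ^d → (ℝ / 2πℤ)^d`. -/
noncomputable def toTorus (d : ℕ) (x : Fin d → ℝ) : Torus d := fun i => (x i : AddCircle (2 * π))

/-- The wrapped normal distribution: the image in the torus of the Gaussian measure on `ℝ^d`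
with mean `t v` and covariance matrix `t I`. -/
noncomputable def wrappedGaussian {d : ℕ} (v : Fin d → ℝ) (t : ℝ≥0) : Measure (Torus d) :=
  (Measure.pi fun i => gaussianReal (t * v i) t).map (toTorus d)

/-- `X` is a Brownian motion on the torus with drift `v`, with an arbitrary (possibly random)
starting point `X 0`. -/
structure IsTorusBrownianMotion {d : ℕ} {Ω : Type*} [MeasurableSpace Ω] (v : Fin d → ℝ)
    (X : ℝ≥0 → Ω → Torus d) (P : Measure Ω) : Prop where
  aemeasurable : ∀ t, AEMeasurable (X t) P
  hasLaw_increment : ∀ s t, HasLaw (fun ω => X (s + t) ω - X s ω) (wrappedGaussian v t) P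
  hasIndepIncrements : HasIndepIncrements X P
  continuous_paths : ∀ᵐ ω ∂P, Continuous fun t => X t ω

/-- The family of functions `F` is reconstructible by the process `X`: a single map `A`, applied to
the trace `t ↦ f (X t)`, almost surely returns a translate of `f` (up to a Lebesgue-null set),
whichever `f ∈ F` produced the trace. -/
def IsReconstructibleBy {d : ℕ} {Ω : Type*} [MeasurableSpace Ω] (F : Set (Torus d → ℝ))
    (X : ℝ≥0 → Ω → Torus d) (P : Measure Ω) : Prop :=
  ∃ A : (ℝ≥0 → ℝ) → (Torus d → ℝ), ∀ f ∈ F, ∀ᵐ ω ∂P, ∃ θ : Torus d,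
    ∀ᵐ x : Torus d, A (fun t => f (X t ω)) x = f (x + θ)

/-- The indicators of open subsets of the torus whose boundary is Lebesgue-null. -/
def openIndicators (d : ℕ) : Set (Torus d → ℝ) :=
  {f | ∃ U : Set (Torus d), IsOpen U ∧ volume (frontier U) = 0 ∧ f = U.indicator 1}

/-! Sample the path on a grid of mesh `h` and cut it into disjoint windows: a starting point
followed by `k` increments over lags `(n i + 1) * h`. The trace shows which sites of each window lie
in `U`. Almost surely the frequency of each in/out pattern converges to its `patternIntegral`, where
the starting point is uniform and the increments have the densities `wrappedDensity`. For characters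
of the window this is a law of large numbers with exactly computed covariances
(`IsTorusBrownianMotion.ae_tendsto_windowChar`); Stone–Weierstrass and the null boundary carry it
over to patterns.

The frequencies determine `U` up to translation. The density at lag `(n + 1) * h` is `∑ z_m ^ (n +
1) • torusChar (-m)` with `z_m = exp (h * levyExponent v m)`. Rational independence of `v` lets `h`
be chosen so that the `z_m` are distinct, and then `mem_of_forall_tsum_pow_smul_mem` isolates each
character in the closed span of these densities. By multilinearity the pattern integrals are known
for all continuous functions of the increments. Concentrating these near prescribed increments shows
that any pattern of `U` along a path avoiding its boundary occurs for `V` along a path with nearly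
the same increments. Applied to a dense sequence of points, with compactness of the torus, this
yields the shift. The map `A` may therefore return any open set with null boundary whose predicted
frequencies match the trace. -/

open Filter Topology ComplexConjugate

/-! ### Isolating terms of power sums; a Stone–Weierstrass criterion. -/

section Analysis

/-- If a closed subspace contains all the power sums `∑ zᵢⁿ⁺¹ eᵢ` for distinct nonzero summable
`zᵢ`, then it contains every `eᵢ`. -/
theorem mem_of_forall_tsum_pow_smul_mem {ι B : Type*} [NormedAddCommGroup B] [NormedSpace ℂ B]
    [CompleteSpace B] {z : ι → ℂ} {e : ι → B} (hinj : Function.Injective z) (hz0 : ∀ i, z i ≠ 0)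
    (hs : Summable fun i => ‖z i‖) (he : ∀ i, ‖e i‖ ≤ 1) {K : Submodule ℂ B}
    (hK : IsClosed (K : Set B)) (hq : ∀ n : ℕ, ∑' i, z i ^ (n + 1) • e i ∈ K) (i : ι) :
    e i ∈ K := by
  classical
  set M : ℝ := ∑' i, ‖z i‖ with hM
  have hzM : ∀ i, ‖z i‖ ≤ M := fun i => hs.le_tsum i fun j _ => norm_nonneg _
  have hM0 : 0 ≤ M := (norm_nonneg _).trans (hzM i)
  have hpow : ∀ n : ℕ, Summable fun i => z i ^ (n + 1) • e i := by
    intro n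
    refine Summable.of_norm_bounded (hs.mul_left (M ^ n)) fun j => ?_
    rw [norm_smul, norm_pow, pow_succ]
    calc ‖z j‖ ^ n * ‖z j‖ * ‖e j‖ ≤ M ^ n * ‖z j‖ * 1 := by
          gcongr
          · exact hzM j
          · exact he j
      _ = _ := mul_one _
  -- Exponents start at 1, so only polynomials without constant term are available; the spare factor
  -- `z i` gives summability.
  have key : ∀ R : Polynomial ℂ, Summable (fun i => (z i * R.eval (z i)) • e i) ∧
      ∑' i, (z i * R.eval (z i)) • e i ∈ K := by
    intro R
    induction R using Polynomial.induction_on' with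
    | add p q hp hq =>
      simp only [Polynomial.eval_add, mul_add, add_smul]
      refine ⟨hp.1.add hq.1, ?_⟩
      rw [hp.1.tsum_add hq.1]
      exact K.add_mem hp.2 hq.2
    | monomial n a =>
      have : ∀ i, (z i * (Polynomial.monomial n a).eval (z i)) • e i = a • (z i ^ (n + 1) • e i) := by
        intro i
        rw [Polynomial.eval_monomial, smul_smul]
        ring_nf
      simp only [this]
      refine ⟨(hpow n).const_smul a, ?_⟩
      rw [(hpow n).tsum_const_smul]
      exact K.smul_mem _ (hq n)
  -- The finitely many competitors of modulus at least `‖z i‖` are killed by a polynomial factor;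
  -- the remaining ones die under high powers of `z j / z i`. Thus `G N j` is 1 at `j = i`, 0 on
  -- `F`, and tends to 0 elsewhere.
  have hfin : {j | ‖z i‖ ≤ ‖z j‖ ∧ j ≠ i}.Finite := by
    have h := hs.tendsto_cofinite_zero
    have h2 : ∀ᶠ j in cofinite, ‖z j‖ < ‖z i‖ := h.eventually_lt_const (norm_pos_iff.2 (hz0 i))
    refine Set.Finite.subset h2 ?_
    rintro j ⟨hj, -⟩
    simpa using hj
  set F := hfin.toFinset with hF
  have hFm : ∀ j, j ∈ F ↔ ‖z i‖ ≤ ‖z j‖ ∧ j ≠ i := fun j => by simp [hF]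
  set D : ℂ := ∏ l ∈ F, (z i - z l) with hD
  have hD0 : D ≠ 0 := Finset.prod_ne_zero_iff.2 fun l hl =>
    sub_ne_zero.2 fun h => ((hFm l).1 hl).2 (hinj h).symm
  let G : ℕ → ι → ℂ := fun N j => (z j / z i) ^ (N + 1) * ((∏ l ∈ F, (z j - z l)) / D)
  have hG : ∀ N, ∑' j, G N j • e j ∈ K := by
    intro N
    have := (key (Polynomial.X ^ N * Polynomial.C ((z i ^ (N + 1) * D)⁻¹) *
      ∏ l ∈ F, (Polynomial.X - Polynomial.C (z l)))).2
    convert this using 4 with j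
    simp only [G, Polynomial.eval_mul, Polynomial.eval_pow, Polynomial.eval_X, Polynomial.eval_C,
      Polynomial.eval_prod, Polynomial.eval_sub]
    have := hz0 i
    rw [div_pow, pow_succ (z j)]
    field_simp
  have hb : ∀ j, ‖(∏ l ∈ F, (z j - z l)) / D‖ ≤ (2 * M) ^ F.card / ‖D‖ := by
    intro j
    rw [norm_div, norm_prod]
    gcongr
    rw [← Finset.prod_const]
    refine Finset.prod_le_prod (fun _ _ => norm_nonneg _) fun l _ => ?_
    calc ‖z j - z l‖ ≤ ‖z j‖ + ‖z l‖ := norm_sub_le _ _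
      _ ≤ 2 * M := by linarith [hzM j, hzM l]
  have hlim : Tendsto (fun N => ∑' j, G N j • e j) atTop (𝓝 (∑' j, if j = i then e j else 0)) := by
    refine tendsto_tsum_of_dominated_convergence
      (bound := fun j => ‖z j‖ * (‖z i‖⁻¹ * ((2 * M) ^ F.card / ‖D‖))) (hs.mul_right _) ?_ ?_
    · intro j
      by_cases hji : j = i
      · subst hji
        have : ∀ N, G N j = 1 := fun N => by
          simp only [G]
          rw [div_self (hz0 j), one_pow, one_mul, ← hD, div_self hD0]
        simp [this]
      rw [if_neg hji]
      by_cases hjF : j ∈ F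
      · have : ∀ N, G N j = 0 := fun N => by
          simp only [G]
          rw [Finset.prod_eq_zero hjF (sub_self _), zero_div, mul_zero]
        simp [this]
      · have hlt : ‖z j / z i‖ < 1 := by
          rw [norm_div, div_lt_one (norm_pos_iff.2 (hz0 i))]
          by_contra hcon
          exact hjF ((hFm j).2 ⟨not_lt.1 hcon, hji⟩)
        have h1 := ((tendsto_pow_atTop_nhds_zero_of_norm_lt_one hlt).comp
          (tendsto_add_atTop_nat 1)).mul_const ((∏ l ∈ F, (z j - z l)) / D)
        have h2 := h1.smul_const (e j)
        simpa [G] using h2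
    · refine Eventually.of_forall fun N j => ?_
      have hR : 0 ≤ ‖z j‖ * (‖z i‖⁻¹ * ((2 * M) ^ F.card / ‖D‖)) := by positivity
      by_cases hjF : j ∈ F
      · simp only [G]
        rw [Finset.prod_eq_zero hjF (sub_self _), zero_div, mul_zero, zero_smul, norm_zero]
        exact hR
      · have hle : ‖z j / z i‖ ≤ 1 := by
          rw [norm_div]
          refine div_le_one_of_le₀ ?_ (norm_nonneg _)
          by_cases hji : j = i
          · rw [hji]
          · by_contra hcon
            exact hjF ((hFm j).2 ⟨(not_le.1 hcon).le, hji⟩)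
        calc ‖G N j • e j‖ ≤ ‖z j / z i‖ ^ (N + 1) * ‖(∏ l ∈ F, (z j - z l)) / D‖ * 1 := by
              rw [norm_smul, norm_mul, norm_pow]
              gcongr
              exact he j
          _ ≤ ‖z j / z i‖ * ((2 * M) ^ F.card / ‖D‖) * 1 := by
              gcongr
              · exact pow_le_of_le_one (norm_nonneg _) hle (Nat.succ_ne_zero N)
              · exact hb j
          _ = _ := by rw [norm_div]; ring
  rw [tsum_ite_eq] at hlim
  exact hK.mem_of_tendsto hlim (Eventually.of_forall hG)

/-- Stone–Weierstrass for the span of a family of functions that is closed under products and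
conjugation. -/
theorem span_range_topologicalClosure_eq_top {E ι : Type*} [TopologicalSpace E] [CompactSpace E]
    (χ : ι → C(E, ℂ)) (hone : 1 ∈ Set.range χ) (hmul : ∀ a b, χ a * χ b ∈ Set.range χ)
    (hstar : ∀ a, star (χ a) ∈ Set.range χ) (hsep : ∀ x y, (∀ a, χ a x = χ a y) → x = y) :
    (Submodule.span ℂ (Set.range χ)).topologicalClosure = ⊤ := by
  let S : Submonoid C(E, ℂ) :=
    { carrier := Set.range χ
      one_mem' := hone
      mul_mem' := by
        rintro _ _ ⟨a, rfl⟩ ⟨b, rfl⟩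
        exact hmul a b }
  let A : StarSubalgebra ℂ C(E, ℂ) :=
    { Algebra.adjoin ℂ (S : Set C(E, ℂ)) with
      star_mem' := by
        intro a ha
        change a ∈ Subalgebra.toSubmodule (Algebra.adjoin ℂ (S : Set C(E, ℂ))) at ha
        change star a ∈ Subalgebra.toSubmodule (Algebra.adjoin ℂ (S : Set C(E, ℂ)))
        -- The range is already a submonoid, so the algebra it generates is merely its linear span.
        rw [Algebra.adjoin_eq_span, Submonoid.closure_eq] at ha ⊢
        induction ha using Submodule.span_induction with
        | mem x hx =>
          obtain ⟨b, rfl⟩ := hx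
          exact Submodule.subset_span (hstar b)
        | zero => simp
        | add x y _ _ hx hy => rw [star_add]; exact Submodule.add_mem _ hx hy
        | smul c x _ hx => rw [star_smul]; exact Submodule.smul_mem _ _ hx }
  have hA : A.topologicalClosure = ⊤ := by
    refine ContinuousMap.starSubalgebra_topologicalClosure_eq_top_of_separatesPoints A ?_
    intro x y hxy
    by_contra! hcon
    refine hxy (hsep x y fun a => hcon (χ a) ?_)
    exact ⟨χ a, Algebra.subset_adjoin ⟨a, rfl⟩, rfl⟩
  have hAS : Subalgebra.toSubmodule A.toSubalgebra = Submodule.span ℂ (Set.range χ) := by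
    change Subalgebra.toSubmodule (Algebra.adjoin ℂ (S : Set C(E, ℂ))) = _
    rw [Algebra.adjoin_eq_span, Submonoid.closure_eq]
    rfl
  rw [← hAS]
  exact congr_arg (Subalgebra.toSubmodule <| StarSubalgebra.toSubalgebra ·) hA

end Analysis

/-! ### Averages along squares: density, indicators, a law of large numbers. -/

section Averages

/-- The average of the first `N²` terms of a sequence. -/
noncomputable def sqAvg (a : ℕ → ℂ) (N : ℕ) : ℂ :=
  ((N : ℂ) ^ 2)⁻¹ * ∑ j ∈ Finset.range (N ^ 2), a j

theorem sqAvg_add (a b : ℕ → ℂ) (N : ℕ) :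
    sqAvg (fun j => a j + b j) N = sqAvg a N + sqAvg b N := by
  simp only [sqAvg, Finset.sum_add_distrib, mul_add]

theorem sqAvg_sub (a b : ℕ → ℂ) (N : ℕ) :
    sqAvg (fun j => a j - b j) N = sqAvg a N - sqAvg b N := by
  simp only [sqAvg, Finset.sum_sub_distrib, mul_sub]

theorem sqAvg_const_mul (c : ℂ) (a : ℕ → ℂ) (N : ℕ) :
    sqAvg (fun j => c * a j) N = c * sqAvg a N := by
  simp only [sqAvg, ← Finset.mul_sum, mul_left_comm]

theorem tendsto_sqAvg_const (c : ℂ) : Tendsto (sqAvg fun _ => c) atTop (𝓝 c) := by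
  refine tendsto_const_nhds.congr' ?_
  filter_upwards [eventually_gt_atTop 0] with N hN
  have : (N : ℂ) ≠ 0 := by exact_mod_cast hN.ne'
  simp [sqAvg, this]

theorem norm_sqAvg_le_of_le {a : ℕ → ℂ} {b : ℕ → ℝ} (h : ∀ j, ‖a j‖ ≤ b j) (N : ℕ) :
    ‖sqAvg a N‖ ≤ ‖sqAvg (fun j => (b j : ℂ)) N‖ := by
  unfold sqAvg
  rw [norm_mul, norm_mul]
  gcongr
  rw [← Complex.ofReal_sum, Complex.norm_real]
  exact (norm_sum_le _ _).trans ((Finset.sum_le_sum fun j _ => h j).trans (le_abs_self _))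

theorem norm_sqAvg_le {a : ℕ → ℂ} {C : ℝ} (hC : 0 ≤ C) (h : ∀ j, ‖a j‖ ≤ C) (N : ℕ) :
    ‖sqAvg a N‖ ≤ C := by
  refine (norm_sqAvg_le_of_le h N).trans ?_
  rcases Nat.eq_zero_or_pos N with rfl | hN
  · simpa [sqAvg] using hC
  · have : (N : ℂ) ≠ 0 := by exact_mod_cast hN.ne'
    simp [sqAvg, this, abs_of_nonneg hC]

/-- Convergence of averages extends from a family of continuous functions to the closure of its
span. -/
theorem tendsto_sqAvg_of_span_dense {E : Type*} [TopologicalSpace E] [CompactSpace E]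
    (z : ℕ → E) (ℓ : C(E, ℂ) →L[ℂ] ℂ) {S : Set C(E, ℂ)}
    (hS : (Submodule.span ℂ S).topologicalClosure = ⊤)
    (h : ∀ F ∈ S, Tendsto (sqAvg fun j => F (z j)) atTop (𝓝 (ℓ F))) (F : C(E, ℂ)) :
    Tendsto (sqAvg fun j => F (z j)) atTop (𝓝 (ℓ F)) := by
  have hspan : ∀ F ∈ Submodule.span ℂ S, Tendsto (sqAvg fun j => F (z j)) atTop (𝓝 (ℓ F)) := by
    intro F hF
    induction hF using Submodule.span_induction with
    | mem F hF => exact h F hF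
    | zero =>
      have : (sqAvg fun j => (0 : C(E, ℂ)) (z j)) = fun _ => 0 := by
        funext N; simp [sqAvg]
      rw [this, map_zero]
      exact tendsto_const_nhds
    | add F G _ _ hF hG =>
      rw [map_add]
      exact (hF.add hG).congr fun N => (sqAvg_add _ _ N).symm
    | smul c F _ hF =>
      rw [map_smul, smul_eq_mul]
      exact (hF.const_mul c).congr fun N => (sqAvg_const_mul _ _ N).symm
  rw [Metric.tendsto_atTop]
  intro ε hε
  have hK : 0 < 1 + ‖ℓ‖ := by positivity
  have hFmem : F ∈ closure (Submodule.span ℂ S : Set C(E, ℂ)) := by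
    rw [← Submodule.topologicalClosure_coe, hS]
    trivial
  obtain ⟨G, hG, hFG⟩ := Metric.mem_closure_iff.1 hFmem (ε / 2 / (1 + ‖ℓ‖)) (by positivity)
  obtain ⟨N₀, hN₀⟩ := Metric.tendsto_atTop.1 (hspan G hG) (ε / 2) (by positivity)
  refine ⟨N₀, fun N hN => ?_⟩
  have h1 : ‖(sqAvg fun j => F (z j)) N - (sqAvg fun j => G (z j)) N‖ ≤ ‖F - G‖ := by
    rw [← sqAvg_sub]
    exact norm_sqAvg_le (norm_nonneg _) (fun j => (F - G).norm_coe_le_norm (z j)) N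
  have h2 : ‖ℓ G - ℓ F‖ ≤ ‖ℓ‖ * ‖F - G‖ := by
    rw [← map_sub, norm_sub_rev F G]
    exact ℓ.le_opNorm _
  have h3 := hN₀ N hN
  rw [dist_eq_norm] at h3 hFG ⊢
  rw [lt_div_iff₀ hK] at hFG
  calc ‖(sqAvg fun j => F (z j)) N - ℓ F‖
      = ‖((sqAvg fun j => F (z j)) N - (sqAvg fun j => G (z j)) N) +
        ((sqAvg fun j => G (z j)) N - ℓ G) + (ℓ G - ℓ F)‖ := by congr 1; ring
    _ ≤ _ := norm_add₃_le
    _ < ε := by linarith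

/-- If the averages of all continuous functions along a sequence converge to integrals against a
continuous density, then so do the averages of the indicator of a set with null boundary. -/
theorem tendsto_sqAvg_indicator {E : Type*} [MetricSpace E] [CompactSpace E] [MeasurableSpace E]
    [BorelSpace E] (μ : Measure E) [IsFiniteMeasure μ] (z : ℕ → E) (w : C(E, ℂ))
    (h : ∀ F : C(E, ℂ), Tendsto (sqAvg fun j => F (z j)) atTop (𝓝 (∫ x, F x * w x ∂μ)))
    {W : Set E} (hWm : MeasurableSet W) (hW : μ (frontier W) = 0) :
    Tendsto (sqAvg fun j => W.indicator 1 (z j)) atTop (𝓝 (∫ x, W.indicator 1 x * w x ∂μ)) := by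
  -- `ψ n` decreases to the indicator of the closure and `φ n` increases to that of the interior, so
  -- the gap `ψ n - φ n` vanishes in the limit off the frontier.
  have hδ : ∀ n : ℕ, 0 < 1 / ((n : ℝ) + 1) := fun n => Nat.one_div_pos_of_nat
  let ψ : ℕ → C(E, ℝ) := fun n => ⟨fun x => (thickenedIndicator (hδ n) W x : ℝ), by fun_prop⟩
  let φ : ℕ → C(E, ℝ) := fun n => ⟨fun x => 1 - (thickenedIndicator (hδ n) Wᶜ x : ℝ), by fun_prop⟩
  have hψ0 : ∀ n x, 0 ≤ ψ n x := fun n x => NNReal.coe_nonneg _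
  have hψ1 : ∀ n x, ψ n x ≤ 1 := fun n x =>
    NNReal.coe_le_one.2 (thickenedIndicator_le_one (hδ n) W x)
  have hφ1 : ∀ n x, φ n x ≤ 1 := fun n x => sub_le_self _ (NNReal.coe_nonneg _)
  have hφ0 : ∀ n x, 0 ≤ φ n x := fun n x => sub_nonneg.2
    (NNReal.coe_le_one.2 (thickenedIndicator_le_one (hδ n) Wᶜ x))
  have hψW : ∀ n x, W.indicator (1 : E → ℝ) x ≤ ψ n x := fun n x => by
    by_cases hx : x ∈ W
    · rw [Set.indicator_of_mem hx]
      exact (NNReal.coe_eq_one.2 (thickenedIndicator_one (hδ n) W hx)).ge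
    · simp [hx, hψ0]
  have hφW : ∀ n x, φ n x ≤ W.indicator (1 : E → ℝ) x := fun n x => by
    by_cases hx : x ∈ W
    · simp [hx, hφ1]
    · rw [Set.indicator_of_notMem hx]
      exact sub_nonpos.2 (NNReal.coe_eq_one.2 (thickenedIndicator_one (hδ n) Wᶜ hx)).ge
  have hWind : Measurable (W.indicator (1 : E → ℝ)) := measurable_one.indicator hWm
  have hint : ∀ F : C(E, ℝ), Integrable F μ := fun F =>
    F.continuous.integrable_of_hasCompactSupport (HasCompactSupport.of_compactSpace _)
  have hη : Tendsto (fun n => ∫ x, (ψ n x - φ n x) ∂μ) atTop (𝓝 0) := by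
    rw [show (0 : ℝ) = ∫ _, (0 : ℝ) ∂μ by simp]
    refine tendsto_integral_of_dominated_convergence (fun _ => 1)
      (fun n => ((ψ n - φ n).continuous).aestronglyMeasurable) (integrable_const _) ?_ ?_
    · refine fun n => Eventually.of_forall fun x => ?_
      rw [Real.norm_eq_abs, abs_le]
      constructor <;> linarith [hψ0 n x, hψ1 n x, hφ0 n x, hφ1 n x]
    · have hfr : ∀ᵐ x ∂μ, x ∉ frontier W := measure_eq_zero_iff_ae_notMem.1 hW
      filter_upwards [hfr] with x hx
      have hlim := tendsto_one_div_add_atTop_nhds_zero_nat (𝕜 := ℝ)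
      have t1 := tendsto_pi_nhds.1 (thickenedIndicator_tendsto_indicator_closure hδ hlim W) x
      have t2 := tendsto_pi_nhds.1 (thickenedIndicator_tendsto_indicator_closure hδ hlim Wᶜ) x
      have t3 := (NNReal.tendsto_coe.2 t1).sub
        ((tendsto_const_nhds (x := (1 : ℝ))).sub (NNReal.tendsto_coe.2 t2))
      refine (congrArg (fun c => Tendsto (fun n => ψ n x - φ n x) atTop (𝓝 c)) ?_).mp t3
      rw [frontier_eq_closure_inter_closure] at hx
      by_cases h1 : x ∈ closure W
      · have h2 : x ∉ closure Wᶜ := fun h2 => hx ⟨h1, h2⟩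
        simp [-closure_compl, h1, h2]
      · have h2 : x ∈ closure Wᶜ := subset_closure fun h2 => h1 (subset_closure h2)
        simp [-closure_compl, h1, h2]
  obtain ⟨C, hC0, hC⟩ : ∃ C : ℝ, 0 < C ∧ ∀ x, ‖w x‖ ≤ C :=
    ⟨‖w‖ + 1, by positivity, fun x => (w.norm_coe_le_norm x).trans (by linarith)⟩
  let toC : C(E, ℝ) → C(E, ℂ) := fun F => ⟨fun x => (F x : ℂ), by fun_prop⟩
  have hindC : ∀ x, W.indicator (1 : E → ℂ) x = ((W.indicator (1 : E → ℝ) x : ℝ) : ℂ) := fun x => by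
    by_cases hx : x ∈ W <;> simp [hx]
  rw [Metric.tendsto_atTop]
  intro ε hε
  obtain ⟨n, hn⟩ : ∃ n, ∫ x, (ψ n x - φ n x) ∂μ < ε / 4 / C :=
    (hη.eventually_lt_const (show (0 : ℝ) < ε / 4 / C by positivity)).exists
  rw [lt_div_iff₀ hC0] at hn
  -- The weight `w` is complex, so integrals against it cannot be sandwiched; errors are dominated
  -- by the gap `ψ n - φ n` instead.
  have hdom : ∀ g : E → ℝ, AEStronglyMeasurable g μ → (∀ x, ‖g x‖ ≤ ψ n x - φ n x) →
      ‖∫ x, (g x : ℂ) * w x ∂μ‖ < ε / 4 := by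
    intro g hg hgb
    refine lt_of_le_of_lt ?_ hn
    rw [← integral_mul_const]
    refine norm_integral_le_of_norm_le (((hint (ψ n - φ n))).mul_const C)
      (Eventually.of_forall fun x => ?_)
    rw [norm_mul, Complex.norm_real]
    exact mul_le_mul (hgb x) (hC x) (norm_nonneg _) ((norm_nonneg _).trans (hgb x))
  obtain ⟨N₁, hN₁⟩ := Metric.tendsto_atTop.1 (h (toC (φ n))) (ε / 4) (by positivity)
  obtain ⟨N₂, hN₂⟩ := Metric.tendsto_atTop.1 (h (toC (ψ n - φ n))) (ε / 4) (by positivity)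
  refine ⟨max N₁ N₂, fun N hN => ?_⟩
  have e1 := hN₁ N ((le_max_left _ _).trans hN)
  have e2 := hN₂ N ((le_max_right _ _).trans hN)
  rw [dist_eq_norm] at e1 e2 ⊢
  have e3 : ‖∫ x, toC (ψ n - φ n) x * w x ∂μ‖ < ε / 4 :=
    hdom (ψ n - φ n) (ψ n - φ n).continuous.aestronglyMeasurable fun x => by
      rw [Real.norm_eq_abs]
      exact (abs_of_nonneg (sub_nonneg.2 ((hφW n x).trans (hψW n x)))).le
  have e4 : ‖∫ x, ((φ n x - W.indicator 1 x : ℝ) : ℂ) * w x ∂μ‖ < ε / 4 :=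
    hdom (fun x => φ n x - W.indicator 1 x)
      ((φ n).continuous.measurable.sub hWind).aestronglyMeasurable fun x => by
        rw [Real.norm_eq_abs, abs_le]
        constructor <;> linarith [hφW n x, hψW n x]
  have e5 : ‖sqAvg (fun j => W.indicator (1 : E → ℂ) (z j)) N - sqAvg (fun j => toC (φ n) (z j)) N‖
      ≤ ‖sqAvg (fun j => toC (ψ n - φ n) (z j)) N‖ := by
    rw [← sqAvg_sub]
    refine norm_sqAvg_le_of_le (b := fun j => (ψ n - φ n) (z j)) (fun j => ?_) N
    rw [hindC]
    change ‖((W.indicator (1 : E → ℝ) (z j) : ℝ) : ℂ) - ((φ n (z j) : ℝ) : ℂ)‖ ≤ ψ n (z j) - φ n (z j)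
    rw [← Complex.ofReal_sub, Complex.norm_real, Real.norm_eq_abs, abs_le]
    constructor <;> linarith [hφW n (z j), hψW n (z j)]
  have hintC : ∀ g : E → ℝ, Measurable g → (∀ x, ‖g x‖ ≤ 1) →
      Integrable (fun x => (g x : ℂ) * w x) μ := by
    intro g hg hg1
    refine Integrable.of_bound (C := 1 * C)
      ((Complex.measurable_ofReal.comp hg).mul w.continuous.measurable).aestronglyMeasurable
      (Eventually.of_forall fun x => ?_)
    rw [norm_mul, Complex.norm_real]
    exact mul_le_mul (hg1 x) (hC x) (norm_nonneg _) zero_le_one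
  have e6 : ∫ x, ((φ n x - W.indicator 1 x : ℝ) : ℂ) * w x ∂μ =
      (∫ x, toC (φ n) x * w x ∂μ) - ∫ x, W.indicator 1 x * w x ∂μ := by
    have i1 : Integrable (fun x => toC (φ n) x * w x) μ :=
      hintC (φ n) (φ n).continuous.measurable fun x => by
        rw [Real.norm_eq_abs, abs_of_nonneg (hφ0 n x)]; exact hφ1 n x
    have i2 : Integrable (fun x => W.indicator (1 : E → ℂ) x * w x) μ := by
      simp only [hindC]
      refine hintC _ hWind fun x => ?_
      by_cases hx : x ∈ W <;> simp [hx]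
    rw [← integral_sub i1 i2]
    congr 1 with x
    rw [hindC, Complex.ofReal_sub, sub_mul]
    rfl
  rw [e6] at e4
  have e7 := norm_sub_norm_le (sqAvg (fun j => toC (ψ n - φ n) (z j)) N)
    (∫ x, toC (ψ n - φ n) x * w x ∂μ)
  calc ‖sqAvg (fun j => W.indicator (1 : E → ℂ) (z j)) N - ∫ x, W.indicator 1 x * w x ∂μ‖
      = ‖(sqAvg (fun j => W.indicator (1 : E → ℂ) (z j)) N - sqAvg (fun j => toC (φ n) (z j)) N) +
        (sqAvg (fun j => toC (φ n) (z j)) N - ∫ x, toC (φ n) x * w x ∂μ) +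
        ((∫ x, toC (φ n) x * w x ∂μ) - ∫ x, W.indicator 1 x * w x ∂μ)‖ := by congr 1; ring
    _ ≤ _ := norm_add₃_le
    _ < ε := by linarith

/-- A continuous multilinear form that vanishes on a family with dense span vanishes. -/
theorem ContinuousMultilinearMap.eq_zero_of_span_dense {ι M : Type*} [Fintype ι]
    [AddCommGroup M] [Module ℂ M] [TopologicalSpace M] [IsTopologicalAddGroup M]
    [ContinuousSMul ℂ M]
    (D : ContinuousMultilinearMap ℂ (fun _ : ι => M) ℂ) {S : Set M}
    (hS : (Submodule.span ℂ S).topologicalClosure = ⊤)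
    (h : ∀ Q : ι → M, (∀ i, Q i ∈ S) → D Q = 0) (Q : ι → M) : D Q = 0 := by
  classical
  -- Slots are freed one at a time: those in `s` are arbitrary, the others still lie in `S`.
  suffices H : ∀ (s : Finset ι) (Q : ι → M), (∀ i ∉ s, Q i ∈ S) → D Q = 0 from
    H Finset.univ Q fun i hi => absurd (Finset.mem_univ i) hi
  intro s
  induction s using Finset.induction_on with
  | empty => exact fun Q hQ => h Q fun i => hQ i (Finset.notMem_empty i)
  | insert a s ha ih =>
    intro Q hQ
    let T := LinearMap.ker (D.toContinuousLinearMap Q a : M →ₗ[ℂ] ℂ)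
    have hT : IsClosed (T : Set M) := (D.toContinuousLinearMap Q a).isClosed_ker
    have hle : (Submodule.span ℂ S).topologicalClosure ≤ T := by
      refine Submodule.topologicalClosure_minimal _ (Submodule.span_le.2 fun x hx => ?_) hT
      refine ih (Function.update Q a x) fun i hi => ?_
      by_cases hia : i = a
      · subst hia; simpa using hx
      · rw [Function.update_of_ne hia]
        exact hQ i (by simp [hia, hi])
    rw [hS] at hle
    have : D (Function.update Q a (Q a)) = 0 := hle (x := Q a) trivial
    rwa [Function.update_eq_self] at this

/-- A strong law of large numbers, along squares, for bounded variables with exponentially decaying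
correlations. -/
theorem ae_tendsto_sqAvg_zero {Ω : Type*} [MeasurableSpace Ω] {P : Measure Ω}
    [IsProbabilityMeasure P] {b : ℕ → Ω → ℂ} (hb : ∀ j, AEStronglyMeasurable (b j) P) {C r : ℝ}
    (hC : ∀ j ω, ‖b j ω‖ ≤ C) (hr0 : 0 ≤ r) (hr1 : r < 1)
    (hcov : ∀ j l, j < l → ‖∫ ω, b j ω * conj (b l ω) ∂P‖ ≤ r ^ (l - j)) :
    ∀ᵐ ω ∂P, Tendsto (sqAvg fun j => b j ω) atTop (𝓝 0) := by
  have hcm : ∀ j, AEStronglyMeasurable (fun ω => conj (b j ω)) P := fun j =>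
    Complex.continuous_conj.comp_aestronglyMeasurable (hb j)
  have hSm : ∀ N, AEStronglyMeasurable (fun ω => ∑ j ∈ Finset.range N, b j ω) P := fun N =>
    Finset.aestronglyMeasurable_fun_sum _ fun j _ => hb j
  have hSb : ∀ N ω, ‖∑ j ∈ Finset.range N, b j ω‖ ≤ N * C := fun N ω => by
    refine (norm_sum_le _ _).trans ((Finset.sum_le_sum fun j _ => hC j ω).trans ?_)
    simp
  have hSi : ∀ N, Integrable (fun ω => ‖∑ j ∈ Finset.range N, b j ω‖ ^ 2) P := fun N => by
    refine Integrable.of_bound (C := (N * C) ^ 2) ((hSm N).norm.pow 2)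
      (Eventually.of_forall fun ω => ?_)
    rw [norm_pow, norm_norm]
    exact pow_le_pow_left₀ (norm_nonneg _) (hSb N ω) 2
  have hbi : ∀ j l, Integrable (fun ω => b j ω * conj (b l ω)) P := fun j l => by
    refine Integrable.of_bound (C := C * C) ((hb j).mul (hcm l)) (Eventually.of_forall fun ω => ?_)
    rw [norm_mul, RCLike.norm_conj]
    exact mul_le_mul (hC j ω) (hC l ω) (norm_nonneg _) ((norm_nonneg _).trans (hC j ω))
  -- Each new term adds at most its own square `C ^ 2` and twice a geometric sum of correlations
  -- with its predecessors, so second moments grow linearly.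
  set K : ℝ := C ^ 2 + 2 * (1 - r)⁻¹ with hK
  have hL2 : ∀ N : ℕ, ∫ ω, ‖∑ j ∈ Finset.range N, b j ω‖ ^ 2 ∂P ≤ N * K := by
    intro N
    induction N with
    | zero => simp
    | succ N ih =>
      have hexp : ∀ ω, ‖∑ j ∈ Finset.range (N + 1), b j ω‖ ^ 2 =
          ‖∑ j ∈ Finset.range N, b j ω‖ ^ 2 + ‖b N ω‖ ^ 2 +
            2 * (∑ j ∈ Finset.range N, b j ω * conj (b N ω)).re := by
        intro ω
        rw [Finset.sum_range_succ, ← Complex.normSq_eq_norm_sq, Complex.normSq_add,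
          Complex.normSq_eq_norm_sq, Complex.normSq_eq_norm_sq, Finset.sum_mul]
      have hi2 : Integrable (fun ω => ‖b N ω‖ ^ 2) P := by
        refine Integrable.of_bound (C := C ^ 2) ((hb N).norm.pow 2)
          (Eventually.of_forall fun ω => ?_)
        rw [norm_pow, norm_norm]
        exact pow_le_pow_left₀ (norm_nonneg _) (hC N ω) 2
      have hi3 : Integrable (fun ω => ∑ j ∈ Finset.range N, b j ω * conj (b N ω)) P :=
        integrable_finsetSum _ fun j _ => hbi j N
      have h2 : ∫ ω, ‖b N ω‖ ^ 2 ∂P ≤ C ^ 2 := by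
        calc _ ≤ ∫ _, C ^ 2 ∂P := integral_mono hi2 (integrable_const _) fun ω =>
              pow_le_pow_left₀ (norm_nonneg _) (hC N ω) 2
          _ = C ^ 2 := by simp
      have h3 : ∫ ω, (∑ j ∈ Finset.range N, b j ω * conj (b N ω)).re ∂P ≤ (1 - r)⁻¹ := by
        have : ∫ ω, (∑ j ∈ Finset.range N, b j ω * conj (b N ω)).re ∂P =
            (∫ ω, ∑ j ∈ Finset.range N, b j ω * conj (b N ω) ∂P).re := integral_re hi3
        rw [this, integral_finsetSum _ fun j _ => hbi j N]
        refine (Complex.re_le_norm _).trans ((norm_sum_le _ _).trans ?_)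
        calc ∑ j ∈ Finset.range N, ‖∫ ω, b j ω * conj (b N ω) ∂P‖
            ≤ ∑ j ∈ Finset.range N, r ^ (N - j) :=
              Finset.sum_le_sum fun j hj => hcov j N (Finset.mem_range.1 hj)
          _ = ∑ j ∈ Finset.range N, r ^ (j + 1) := by
              rw [← Finset.sum_range_reflect]
              refine Finset.sum_congr rfl fun j hj => ?_
              have := Finset.mem_range.1 hj
              congr 1
              omega
          _ ≤ ∑ j ∈ Finset.range N, r ^ j :=
              Finset.sum_le_sum fun j _ => pow_le_pow_of_le_one hr0 hr1.le (Nat.le_succ j)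
          _ ≤ ∑' j : ℕ, r ^ j := (summable_geometric_of_lt_one hr0 hr1).sum_le_tsum _
              fun j _ => pow_nonneg hr0 j
          _ = (1 - r)⁻¹ := tsum_geometric_of_lt_one hr0 hr1
      simp only [hexp]
      have hi3r : Integrable
          (fun ω => 2 * (∑ j ∈ Finset.range N, b j ω * conj (b N ω)).re) P := hi3.re.const_mul 2
      rw [integral_add (f := fun ω => ‖∑ j ∈ Finset.range N, b j ω‖ ^ 2 + ‖b N ω‖ ^ 2)
        ((hSi N).add hi2) hi3r, integral_add (hSi N) hi2, integral_const_mul]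
      push_cast
      linarith
  have hK0 : 0 ≤ K := by
    have : 0 ≤ (1 - r)⁻¹ := inv_nonneg.2 (by linarith)
    positivity
  -- Averaging `N ^ 2` terms makes the second moment at most `K / N ^ 2`, which is summable; hence
  -- the squared averages are almost surely summable and tend to 0.
  have hf : ∀ N : ℕ, ∫⁻ ω, ENNReal.ofReal (‖sqAvg (fun j => b j ω) N‖ ^ 2) ∂P ≤
      ENNReal.ofReal (K * ((N : ℝ) ^ 2)⁻¹) := by
    intro N
    have hrw : ∀ ω, ‖sqAvg (fun j => b j ω) N‖ ^ 2 =
        (((N : ℝ) ^ 2)⁻¹) ^ 2 * ‖∑ j ∈ Finset.range (N ^ 2), b j ω‖ ^ 2 := by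
      intro ω
      simp [sqAvg, mul_pow]
    simp only [hrw]
    rw [← ofReal_integral_eq_lintegral_ofReal ((hSi _).const_mul _)
      (Eventually.of_forall fun ω => by positivity), integral_const_mul]
    refine ENNReal.ofReal_le_ofReal ?_
    rcases Nat.eq_zero_or_pos N with rfl | hN
    · simp
    · have hN' : (0 : ℝ) < N := by exact_mod_cast hN
      calc (((N : ℝ) ^ 2)⁻¹) ^ 2 * ∫ ω, ‖∑ j ∈ Finset.range (N ^ 2), b j ω‖ ^ 2 ∂P
          ≤ (((N : ℝ) ^ 2)⁻¹) ^ 2 * ((N ^ 2 : ℕ) * K) := by gcongr; exact hL2 _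
        _ = K * ((N : ℝ) ^ 2)⁻¹ := by push_cast; field_simp
  have hmeas : ∀ N, AEMeasurable (fun ω => ENNReal.ofReal (‖sqAvg (fun j => b j ω) N‖ ^ 2)) P :=
    fun N => (((hSm (N ^ 2)).const_mul _).norm.pow 2).aemeasurable.ennreal_ofReal
  have hsum : ∫⁻ ω, ∑' N, ENNReal.ofReal (‖sqAvg (fun j => b j ω) N‖ ^ 2) ∂P ≠ ⊤ := by
    rw [lintegral_tsum hmeas]
    refine ne_top_of_le_ne_top ?_ (ENNReal.tsum_le_tsum hf)
    have hs : Summable fun N : ℕ => K * ((N : ℝ) ^ 2)⁻¹ :=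
      (Real.summable_nat_pow_inv.2 one_lt_two).mul_left K
    rw [← ENNReal.ofReal_tsum_of_nonneg (fun N => by positivity) hs]
    exact ENNReal.ofReal_ne_top
  filter_upwards [ae_lt_top' (AEMeasurable.tsum hmeas) hsum] with ω hω
  have h0 := ENNReal.tendsto_atTop_zero_of_tsum_ne_top hω.ne
  have h1 := (ENNReal.tendsto_toReal ENNReal.zero_ne_top).comp h0
  have h2 : Tendsto (fun N => ‖sqAvg (fun j => b j ω) N‖ ^ 2) atTop (𝓝 0) := by
    exact h1.congr fun N => by simp
  rw [tendsto_zero_iff_norm_tendsto_zero]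
  have h3 := h2.sqrt
  simpa [Real.sqrt_sq] using h3

end Averages

/-! ### Characters of the torus and the Fourier transform of the wrapped Gaussian. -/

section Torus

variable {d : ℕ}

/-- Normalised Haar measure on the torus. -/
noncomputable def torusHaar (d : ℕ) : Measure (Torus d) :=
  Measure.pi fun _ => AddCircle.haarAddCircle

instance : IsProbabilityMeasure (torusHaar d) := by unfold torusHaar; infer_instance

instance : (torusHaar d).IsAddHaarMeasure := by unfold torusHaar; infer_instance

theorem torusHaar_absolutelyContinuous : torusHaar d ≪ volume := by
  rw [Measure.isAddLeftInvariant_eq_smul (torusHaar d) volume]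
  exact Measure.smul_absolutelyContinuous

/-- The character `x ↦ exp (i m · x)` of the torus. -/
noncomputable def torusChar (m : Fin d → ℤ) : C(Torus d, ℂ) :=
  ⟨fun x => ∏ i, fourier (m i) (x i), by fun_prop⟩

theorem torusChar_apply (m : Fin d → ℤ) (x : Torus d) :
    torusChar m x = ∏ i, fourier (m i) (x i) := rfl

theorem fourier_add_arg {T : ℝ} (n : ℤ) (x y : AddCircle T) :
    fourier n (x + y) = fourier n x * fourier n y := by
  simp only [fourier_apply, smul_add, AddCircle.toCircle_add, Circle.coe_mul]

theorem torusChar_add (m : Fin d → ℤ) (x y : Torus d) :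
    torusChar m (x + y) = torusChar m x * torusChar m y := by
  simp only [torusChar_apply, Pi.add_apply, fourier_add_arg, Finset.prod_mul_distrib]

@[simp] theorem norm_torusChar_apply (m : Fin d → ℤ) (x : Torus d) : ‖torusChar m x‖ = 1 := by
  simp [torusChar_apply, norm_prod, Circle.norm_coe]

theorem norm_torusChar_le (m : Fin d → ℤ) : ‖torusChar m‖ ≤ 1 :=
  (ContinuousMap.norm_le _ zero_le_one).2 fun x => (norm_torusChar_apply m x).le

@[simp] theorem torusChar_zero_index (x : Torus d) : torusChar (0 : Fin d → ℤ) x = 1 := by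
  simp [torusChar_apply]

@[simp] theorem torusChar_zero (m : Fin d → ℤ) : torusChar m 0 = 1 := by
  simp [torusChar_apply]

theorem torusChar_add_index (m n : Fin d → ℤ) (x : Torus d) :
    torusChar (m + n) x = torusChar m x * torusChar n x := by
  simp only [torusChar_apply, Pi.add_apply, fourier_add, Finset.prod_mul_distrib]

theorem torusChar_neg_index (m : Fin d → ℤ) (x : Torus d) :
    torusChar (-m) x = conj (torusChar m x) := by
  simp only [torusChar_apply, Pi.neg_apply, fourier_neg, map_prod]

theorem torusChar_sum {ι : Type*} (s : Finset ι) (m : Fin d → ℤ) (x : ι → Torus d) :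
    torusChar m (∑ i ∈ s, x i) = ∏ i ∈ s, torusChar m (x i) := by
  classical
  induction s using Finset.induction_on with
  | empty => simp
  | insert a s ha ih => rw [Finset.sum_insert ha, Finset.prod_insert ha, torusChar_add, ih]

theorem torusChar_mul_conj (m : Fin d → ℤ) (x : Torus d) :
    torusChar m x * conj (torusChar m x) = 1 := by
  rw [← torusChar_neg_index, ← torusChar_add_index, add_neg_cancel, torusChar_zero_index]

theorem torusChar_sub (m : Fin d → ℤ) (x y : Torus d) :
    torusChar m (x - y) = torusChar m x * conj (torusChar m y) := by
  calc torusChar m (x - y)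
      = torusChar m (x - y) * (torusChar m y * conj (torusChar m y)) := by
        rw [torusChar_mul_conj, mul_one]
    _ = _ := by rw [← mul_assoc, ← torusChar_add, sub_add_cancel]

theorem eq_of_torusChar_eq {x y : Torus d} (h : ∀ m, torusChar m x = torusChar m y) : x = y := by
  classical
  funext i
  have key : ∀ x : Torus d, torusChar (Pi.single i 1) x = fourier 1 (x i) := by
    intro x
    rw [torusChar_apply, Finset.prod_eq_single i]
    · simp
    · intro j _ hj
      simp [Pi.single_eq_of_ne hj]
    · simp
  have h1 := h (Pi.single i 1)
  rw [key, key, fourier_one, fourier_one] at h1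
  exact AddCircle.injective_toCircle (Real.two_pi_pos.ne') (Subtype.ext h1)

theorem integral_fourier_haarAddCircle {T : ℝ} [hT : Fact (0 < T)] {n : ℤ} (hn : n ≠ 0) :
    ∫ x : AddCircle T, fourier n x ∂AddCircle.haarAddCircle = 0 :=
  integral_eq_zero_of_add_right_eq_neg (μ := AddCircle.haarAddCircle)
    (fourier_add_half_inv_index hn hT.out)

theorem integral_torusChar (m : Fin d → ℤ) :
    ∫ x, torusChar m x ∂torusHaar d = if m = 0 then 1 else 0 := by
  split_ifs with h
  · subst h
    simp
  · obtain ⟨i, hi⟩ := Function.ne_iff.1 h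
    simp only [torusChar_apply]
    unfold torusHaar
    rw [integral_fintype_prod_eq_prod (fun i (x : AddCircle (2 * π)) => fourier (m i) x)]
    exact Finset.prod_eq_zero (Finset.mem_univ i) (integral_fourier_haarAddCircle hi)

/-- The Lévy exponent of Brownian motion with drift `v` at the frequency `m`. -/
noncomputable def levyExponent (v : Fin d → ℝ) (m : Fin d → ℤ) : ℂ :=
  ∑ i, ((m i * v i : ℝ) * Complex.I - (m i : ℂ) ^ 2 / 2)

theorem levyExponent_eq (v : Fin d → ℝ) (m : Fin d → ℤ) :
    levyExponent v m = ((∑ i, m i * v i : ℝ) : ℂ) * Complex.I - ((∑ i, (m i : ℝ) ^ 2 / 2 : ℝ) : ℂ) := by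
  simp only [levyExponent, Finset.sum_sub_distrib, ← Finset.sum_mul, Complex.ofReal_sum]
  push_cast
  rfl

theorem continuous_toTorus : Continuous (toTorus d) :=
  continuous_pi fun i => (AddCircle.continuous_mk' _).comp (continuous_apply i)

theorem integral_torusChar_wrappedGaussian (v : Fin d → ℝ) (t : ℝ≥0) (m : Fin d → ℤ) :
    ∫ x, torusChar m x ∂wrappedGaussian v t = Complex.exp (t * levyExponent v m) := by
  unfold wrappedGaussian
  rw [integral_map continuous_toTorus.aemeasurable
    (torusChar m).continuous.aestronglyMeasurable]
  have h1 : ∀ x : Fin d → ℝ, torusChar m (toTorus d x) =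
      ∏ i, Complex.exp ((m i : ℝ) * x i * Complex.I) := by
    intro x
    rw [torusChar_apply]
    refine Finset.prod_congr rfl fun i _ => ?_
    rw [toTorus, fourier_coe_apply]
    congr 1
    have : (π : ℂ) ≠ 0 := by exact_mod_cast Real.pi_ne_zero
    push_cast
    field_simp
  simp only [h1]
  rw [integral_fintype_prod_eq_prod
    (fun i (x : ℝ) => Complex.exp ((m i : ℝ) * x * Complex.I))]
  have h2 : ∀ i, ∫ x, Complex.exp ((m i : ℝ) * x * Complex.I) ∂gaussianReal (t * v i) t =
      Complex.exp (t * ((m i * v i : ℝ) * Complex.I - (m i : ℂ) ^ 2 / 2)) := by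
    intro i
    rw [← charFun_apply_real, charFun_gaussianReal]
    congr 1
    push_cast
    ring
  simp only [h2]
  rw [← Complex.exp_sum, levyExponent, Finset.mul_sum]

theorem norm_exp_mul_levyExponent (v : Fin d → ℝ) (t : ℝ) (m : Fin d → ℤ) :
    ‖Complex.exp (t * levyExponent v m)‖ = ∏ i, Real.exp (-(t / 2) * (m i : ℝ) ^ 2) := by
  rw [Complex.norm_exp, levyExponent_eq, ← Real.exp_sum]
  congr 1
  rw [Complex.re_ofReal_mul]
  simp only [Complex.sub_re, Complex.re_ofReal_mul, Complex.I_re, mul_zero, Complex.ofReal_re,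
    zero_sub, mul_neg, Finset.mul_sum, ← Finset.sum_neg_distrib]
  refine Finset.sum_congr rfl fun i _ => ?_
  ring

/-- A finite set of multi-indices sits in a box, over which the sum of products factors. -/
theorem summable_prod_pi {g : ℤ → ℝ} (hg : Summable g) (hg0 : ∀ n, 0 ≤ g n) :
    Summable fun m : Fin d → ℤ => ∏ i, g (m i) := by
  classical
  refine summable_of_sum_le (c := (∑' n, g n) ^ d)
    (fun m => Finset.prod_nonneg fun i _ => hg0 _) fun s => ?_
  let S : Finset ℤ := Finset.univ.biUnion fun i : Fin d => s.image fun m => m i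
  have hsS : s ⊆ Fintype.piFinset fun _ => S := by
    intro m hm
    refine Fintype.mem_piFinset.2 fun i => ?_
    exact Finset.mem_biUnion.2 ⟨i, Finset.mem_univ i, Finset.mem_image_of_mem _ hm⟩
  calc ∑ m ∈ s, ∏ i, g (m i)
      ≤ ∑ m ∈ Fintype.piFinset fun _ => S, ∏ i, g (m i) :=
        Finset.sum_le_sum_of_subset_of_nonneg hsS fun m _ _ => Finset.prod_nonneg fun i _ => hg0 _
    _ = ∏ _i : Fin d, ∑ n ∈ S, g n := (Finset.prod_univ_sum (fun _ => S) fun _ n => g n).symm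
    _ ≤ ∏ _i : Fin d, ∑' n, g n :=
        Finset.prod_le_prod (fun _ _ => Finset.sum_nonneg fun n _ => hg0 n)
          fun _ _ => hg.sum_le_tsum _ fun n _ => hg0 n
    _ = _ := by simp

theorem summable_exp_neg_mul_sq {a : ℝ} (ha : 0 < a) :
    Summable fun n : ℤ => Real.exp (-a * (n : ℝ) ^ 2) := by
  have hnat : Summable fun n : ℕ => Real.exp (-a * (n : ℝ) ^ 2) := by
    have h := Real.summable_exp_nat_mul_iff.2 (neg_lt_zero.2 ha)
    refine Summable.of_nonneg_of_le (fun n => (Real.exp_pos _).le) (fun n => ?_) h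
    refine Real.exp_le_exp.2 ?_
    have : (n : ℝ) ≤ (n : ℝ) ^ 2 := by exact_mod_cast Nat.le_self_pow two_ne_zero n
    nlinarith
  refine Summable.of_nat_of_neg ?_ ?_
  · simpa using hnat
  · simpa using hnat

theorem summable_norm_exp_mul_levyExponent (v : Fin d → ℝ) {t : ℝ} (ht : 0 < t) :
    Summable fun m : Fin d → ℤ => ‖Complex.exp (t * levyExponent v m)‖ := by
  simp only [norm_exp_mul_levyExponent]
  exact summable_prod_pi (g := fun n => Real.exp (-(t / 2) * (n : ℝ) ^ 2))
    (summable_exp_neg_mul_sq (half_pos ht)) fun n => (Real.exp_pos _).le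

theorem norm_exp_mul_levyExponent_lt_one (v : Fin d → ℝ) {t : ℝ} (ht : 0 < t) {m : Fin d → ℤ}
    (hm : m ≠ 0) : ‖Complex.exp (t * levyExponent v m)‖ < 1 := by
  rw [norm_exp_mul_levyExponent, ← Real.exp_sum, Real.exp_lt_one_iff, ← Finset.mul_sum]
  obtain ⟨i, hi⟩ := Function.ne_iff.1 hm
  have : 0 < ∑ i, (m i : ℝ) ^ 2 := by
    refine Finset.sum_pos' (fun i _ => sq_nonneg _) ⟨i, Finset.mem_univ i, ?_⟩
    have : (m i : ℝ) ≠ 0 := by exact_mod_cast hi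
    positivity
  exact mul_neg_of_neg_of_pos (neg_lt_zero.2 (half_pos ht)) this

/-- For rationally independent drift, some sampling step separates all the frequencies. -/
theorem exists_injective_exp_mul_levyExponent {v : Fin d → ℝ} (hv : LinearIndependent ℚ v) :
    ∃ h : ℝ≥0, 0 < h ∧ Function.Injective fun m : Fin d → ℤ =>
      Complex.exp ((h : ℝ) * levyExponent v m) := by
  have hvm : ∀ m : Fin d → ℤ, ∑ i, (m i : ℝ) * v i = 0 → m = 0 := by
    intro m hm
    have := Fintype.linearIndependent_iff.1 hv (fun i => (m i : ℚ)) (by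
      simpa [Rat.smul_def] using hm)
    funext i
    exact_mod_cast this i
  -- Equality of the exponentials at `m` and `m'` forces, on imaginary parts, `h * ∑ (m - m') i * v
  -- i ∈ 2πℤ`. These countably many `h` are avoided; a zero denominator only contributes the point
  -- 0.
  let B : Set ℝ := ⋃ (m : Fin d → ℤ) (k : ℤ), {k * (2 * π) / ∑ i, (m i : ℝ) * v i}
  have hB : B.Countable := Set.countable_iUnion fun m => Set.countable_iUnion fun k =>
    Set.countable_singleton _
  obtain ⟨h, hh0, hhB⟩ : ∃ h ∈ Set.Ioi (0 : ℝ), h ∉ B := by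
    by_contra! hcon
    have h0 := (hB.mono hcon).measure_zero volume
    simp at h0
  refine ⟨⟨h, (Set.mem_Ioi.1 hh0).le⟩, hh0, fun m m' hmm => ?_⟩
  by_contra hne
  obtain ⟨k, hk⟩ := Complex.exp_eq_exp_iff_exists_int.1 hmm
  have him := congrArg Complex.im hk
  simp only [levyExponent_eq] at him
  simp only [Complex.im_ofReal_mul, Complex.sub_im, Complex.ofReal_im,
    Complex.add_im, Complex.I_im, sub_zero, mul_one] at him
  have hs : ∑ i, ((m - m') i : ℝ) * v i = ∑ i, (m i : ℝ) * v i - ∑ i, (m' i : ℝ) * v i := by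
    rw [← Finset.sum_sub_distrib]
    refine Finset.sum_congr rfl fun i _ => ?_
    rw [Pi.sub_apply]
    push_cast
    ring
  have hs0 : ∑ i, ((m - m') i : ℝ) * v i ≠ 0 := fun h0 => hne (sub_eq_zero.1 (hvm _ h0))
  refine hhB (Set.mem_iUnion.2 ⟨m - m', Set.mem_iUnion.2 ⟨k, ?_⟩⟩)
  rw [Set.mem_singleton_iff, eq_div_iff hs0, hs]
  have hk2 : ((k : ℂ) * (2 * π * Complex.I)).im = k * (2 * π) := by
    simp
  rw [hk2] at him
  change h * _ = h * _ + _ at him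
  linarith

end Torus

/-! ### The wrapped density as a Fourier series, and the span of its values at grid times. -/

section Density

variable {d : ℕ}

/-- The density of the wrapped Gaussian with respect to Haar measure, as a Fourier series. -/
noncomputable def wrappedDensity (v : Fin d → ℝ) (t : ℝ) : C(Torus d, ℂ) :=
  ∑' m : Fin d → ℤ, Complex.exp (t * levyExponent v m) • torusChar (-m)

theorem summable_wrappedDensity (v : Fin d → ℝ) {t : ℝ} (ht : 0 < t) :
    Summable fun m : Fin d → ℤ => Complex.exp (t * levyExponent v m) • torusChar (-m) := by
  refine Summable.of_norm_bounded (summable_norm_exp_mul_levyExponent v ht) fun m => ?_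
  rw [norm_smul]
  exact mul_le_of_le_one_right (norm_nonneg _) (norm_torusChar_le _)

/-- Integration of continuous functions against a bounded measurable function, as a continuous
linear functional. -/
noncomputable def integralMulCLM {E : Type*} [TopologicalSpace E] [CompactSpace E]
    [MeasurableSpace E] [BorelSpace E] (μ : Measure E) [IsFiniteMeasure μ] (g : E → ℂ)
    (hg : Measurable g) {C : ℝ} (hgC : ∀ x, ‖g x‖ ≤ C) : C(E, ℂ) →L[ℂ] ℂ :=
  have hint : ∀ F : C(E, ℂ), Integrable (fun x => g x * F x) μ := fun F =>
    Integrable.of_bound (C := C * ‖F‖) (hg.mul F.continuous.measurable).aestronglyMeasurable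
      (Eventually.of_forall fun x => by
        rw [norm_mul]
        exact mul_le_mul (hgC x) (F.norm_coe_le_norm x) (norm_nonneg _)
          ((norm_nonneg _).trans (hgC x)))
  LinearMap.mkContinuous
    { toFun := fun F => ∫ x, g x * F x ∂μ
      map_add' := fun F G => by
        rw [← integral_add (hint F) (hint G)]
        simp only [ContinuousMap.add_apply, mul_add]
      map_smul' := fun c F => by
        rw [RingHom.id_apply, smul_eq_mul, ← integral_const_mul]
        simp only [ContinuousMap.smul_apply, smul_eq_mul, mul_left_comm] }
    (C * μ.real Set.univ) fun F => by
      rw [mul_right_comm]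
      refine norm_integral_le_of_norm_le_const (Eventually.of_forall fun x => ?_)
      rw [norm_mul]
      exact mul_le_mul (hgC x) (F.norm_coe_le_norm x) (norm_nonneg _)
        ((norm_nonneg _).trans (hgC x))

/-- By orthogonality one term of the series survives. Agreement with
`integral_torusChar_wrappedGaussian` is the only sense in which `wrappedDensity` needs to be a
density; its positivity plays no role. -/
theorem integral_torusChar_mul_wrappedDensity (v : Fin d → ℝ) {t : ℝ} (ht : 0 < t)
    (m : Fin d → ℤ) :
    ∫ x, torusChar m x * wrappedDensity v t x ∂torusHaar d = Complex.exp (t * levyExponent v m) := by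
  have h := (integralMulCLM (torusHaar d) (torusChar m) (torusChar m).continuous.measurable
    fun x => (norm_torusChar_apply m x).le).map_tsum (summable_wrappedDensity v ht)
  change ∫ x, torusChar m x * wrappedDensity v t x ∂torusHaar d = _ at h
  rw [h, tsum_eq_single m]
  · rw [map_smul, smul_eq_mul]
    change _ * ∫ x, torusChar m x * torusChar (-m) x ∂torusHaar d = _
    simp only [← torusChar_add_index, integral_torusChar, add_neg_cancel, if_true, mul_one]
  · intro m' hm'
    rw [map_smul, smul_eq_mul]
    change _ * ∫ x, torusChar m x * torusChar (-m') x ∂torusHaar d = _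
    simp only [← torusChar_add_index, integral_torusChar]
    rw [if_neg, mul_zero]
    rw [← sub_eq_add_neg, sub_eq_zero]
    exact hm'.symm

theorem span_torusChar_topologicalClosure_eq_top :
    (Submodule.span ℂ (Set.range (torusChar (d := d)))).topologicalClosure = ⊤ := by
  refine span_range_topologicalClosure_eq_top _ ⟨0, ?_⟩ (fun a b => ⟨a + b, ?_⟩)
    (fun a => ⟨-a, ?_⟩) fun x y h => eq_of_torusChar_eq h
  · ext x; simp
  · ext x; exact torusChar_add_index a b x
  · ext x; exact torusChar_neg_index a x

/-- The densities at grid times are the power sums of the distinct, summable numbers `exp (h *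
levyExponent v m)`, so the closed span contains every character. -/
theorem span_wrappedDensity_topologicalClosure_eq_top {v : Fin d → ℝ} {h : ℝ} (hh : 0 < h)
    (hinj : Function.Injective fun m : Fin d → ℤ => Complex.exp (h * levyExponent v m)) :
    (Submodule.span ℂ (Set.range fun n : ℕ =>
      wrappedDensity v (((n + 1 : ℕ) : ℝ) * h))).topologicalClosure = ⊤ := by
  set K := (Submodule.span ℂ (Set.range fun n : ℕ =>
      wrappedDensity v (((n + 1 : ℕ) : ℝ) * h))).topologicalClosure with hK
  have hmem : ∀ m : Fin d → ℤ, torusChar (-m) ∈ K := by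
    refine mem_of_forall_tsum_pow_smul_mem hinj (fun m => Complex.exp_ne_zero _)
      (summable_norm_exp_mul_levyExponent v hh) (fun m => norm_torusChar_le _)
      (Submodule.isClosed_topologicalClosure _) fun n => ?_
    refine Submodule.le_topologicalClosure _ (Submodule.subset_span ⟨n, ?_⟩)
    unfold wrappedDensity
    refine tsum_congr fun m => ?_
    rw [← Complex.exp_nat_mul]
    congr 2
    push_cast
    ring
  rw [eq_top_iff, ← span_torusChar_topologicalClosure_eq_top]
  refine Submodule.topologicalClosure_minimal _ (Submodule.span_le.2 ?_)
    (Submodule.isClosed_topologicalClosure _)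
  rintro _ ⟨m, rfl⟩
  simpa using hmem (-m)

end Density

/-! ### Windows, their patterns, and integrals over patterns. -/

section Window

variable {d k : ℕ}

instance : BorelSpace (Fin k → Torus d) := Pi.borelSpace (X := fun _ : Fin k => Torus d)

/-- A window of a path on the torus: `k` successive increments together with the starting point. -/
abbrev Window (d k : ℕ) : Type := (Fin k → Torus d) × Torus d

/-- Haar measure on the space of windows. -/
noncomputable abbrev windowHaar (d k : ℕ) : Measure (Window d k) :=
  (Measure.pi fun _ : Fin k => torusHaar d).prod (torusHaar d)

/-- The position after `i` increments. -/
noncomputable def windowSite (x : Window d k) (i : ℕ) : Torus d :=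
  x.2 + ∑ l ∈ Finset.univ.filter fun l : Fin k => (l : ℕ) < i, x.1 l

theorem continuous_windowSite (i : ℕ) : Continuous fun x : Window d k => windowSite x i := by
  unfold windowSite
  fun_prop

theorem sum_filter_val_lt {M : Type*} [AddCommMonoid M] (g : ℕ → M) {i : ℕ} (hi : i ≤ k) :
    ∑ l ∈ Finset.univ.filter fun l : Fin k => (l : ℕ) < i, g l = ∑ l ∈ Finset.range i, g l := by
  rw [Finset.sum_filter, Fin.sum_univ_eq_sum_range (fun l => if l < i then g l else 0) k,
    ← Finset.sum_filter]
  congr 1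
  ext l
  simp only [Finset.mem_filter, Finset.mem_range]
  omega

/-- The windows of a path `u` pass through `u 0`, `u 1`, ... -/
theorem windowSite_path (u : ℕ → Torus d) {i : ℕ} (hi : i ≤ k) :
    windowSite ((fun l : Fin k => u (l + 1) - u l, u 0) : Window d k) i = u i := by
  unfold windowSite
  rw [sum_filter_val_lt (fun l => u (l + 1) - u l) hi, Finset.sum_range_sub]
  exact add_sub_cancel _ _

/-- The windows whose `i`-th site lies in `U` exactly for `i ∈ p`. -/
def windowPattern (U : Set (Torus d)) (k : ℕ) (p : Finset ℕ) : Set (Window d k) :=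
  {x | ∀ i ≤ k, windowSite x i ∈ U ↔ i ∈ p}

theorem measurableSet_windowPattern {U : Set (Torus d)} (hU : MeasurableSet U) (p : Finset ℕ) :
    MeasurableSet (windowPattern U k p) := by
  have : windowPattern U k p = ⋂ i : ℕ, ⋂ _ : i ≤ k, {x | windowSite x i ∈ U ↔ i ∈ p} := by
    ext x
    simp [windowPattern]
  rw [this]
  refine MeasurableSet.iInter fun i => MeasurableSet.iInter fun _ => ?_
  have hm : MeasurableSet {x : Window d k | windowSite x i ∈ U} :=
    (continuous_windowSite i).measurable hU
  by_cases hp : i ∈ p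
  · simpa only [hp, iff_true] using hm
  · simp only [hp, iff_false]
    exact hm.compl

theorem windowPattern_mem_nhds {U : Set (Torus d)} {p : Finset ℕ} {x : Window d k}
    (hx : x ∈ windowPattern U k p) (hfr : ∀ i ≤ k, windowSite x i ∉ frontier U) :
    windowPattern U k p ∈ 𝓝 x := by
  have : windowPattern U k p = ⋂ i ∈ Finset.range (k + 1), {x | windowSite x i ∈ U ↔ i ∈ p} := by
    ext x
    simp [windowPattern]
  rw [this, Filter.biInter_finset_mem]
  intro i hi
  have hik : i ≤ k := Nat.lt_succ_iff.1 (Finset.mem_range.1 hi)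
  have hc := (continuous_windowSite (d := d) (k := k) i).continuousAt (x := x)
  by_cases hp : i ∈ p
  · have h1 : windowSite x i ∈ U := (hx i hik).2 hp
    have h2 : windowSite x i ∈ interior U := by
      by_contra h
      exact hfr i hik ⟨subset_closure h1, h⟩
    filter_upwards [hc (mem_interior_iff_mem_nhds.1 h2)] with y hy
    exact iff_of_true hy hp
  · have h1 : windowSite x i ∉ U := fun h => hp ((hx i hik).1 h)
    have h2 : windowSite x i ∈ (closure U)ᶜ := fun h =>
      hfr i hik ⟨h, fun h' => h1 (interior_subset h')⟩
    filter_upwards [hc (isClosed_closure.isOpen_compl.mem_nhds h2)] with y hy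
    exact iff_of_false (fun h => hy (subset_closure h)) hp

/-- If no site of a window is on the frontier of `U`, all nearby windows share its pattern, so it is
interior to `windowPattern U k p` or to the complement. -/
theorem frontier_windowPattern_subset (U : Set (Torus d)) (p : Finset ℕ) :
    frontier (windowPattern U k p) ⊆ ⋃ i : ℕ, {x | windowSite x i ∈ frontier U} := by
  intro x hx
  by_contra hcon
  simp only [Set.mem_iUnion, Set.mem_ofPred_eq, not_exists] at hcon
  obtain ⟨q, hq, hqk⟩ : ∃ q : Finset ℕ, x ∈ windowPattern U k q ∧ ∀ i ∈ q, i ≤ k := by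
    classical
    refine ⟨(Finset.range (k + 1)).filter fun i => windowSite x i ∈ U, fun i hi => ?_, fun i hi => ?_⟩
    · simp [hi]
    · simpa [Nat.lt_succ_iff] using (Finset.mem_filter.1 hi).1
  have hn := windowPattern_mem_nhds hq fun i _ => hcon i
  by_cases hxp : x ∈ windowPattern U k p
  · exact hx.2 (mem_interior_iff_mem_nhds.2 (windowPattern_mem_nhds hxp fun i _ => hcon i))
  · have hne : ∃ i ≤ k, ¬ (i ∈ q ↔ i ∈ p) := by
      by_contra! hall
      exact hxp fun i hi => (hq i hi).trans (hall i hi)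
    obtain ⟨i, hi, hip⟩ := hne
    obtain ⟨y, hy1, hy2⟩ := mem_closure_iff_nhds.1 hx.1 _ hn
    exact hip ((hy1 i hi).symm.trans (hy2 i hi))

/-- Fubini: for fixed increments each site is a translate of the uniform starting point, hence
almost surely off the null set `frontier U`. -/
theorem windowHaar_frontier_windowPattern {U : Set (Torus d)} (hU : volume (frontier U) = 0)
    (p : Finset ℕ) : windowHaar d k (frontier (windowPattern U k p)) = 0 := by
  refine measure_mono_null (frontier_windowPattern_subset U p) (measure_iUnion_null fun i => ?_)
  have hm : MeasurableSet {x : Window d k | windowSite x i ∈ frontier U} :=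
    (continuous_windowSite i).measurable isClosed_frontier.measurableSet
  rw [Measure.measure_prod_null hm]
  refine Eventually.of_forall fun y => ?_
  have : Prod.mk y ⁻¹' {x : Window d k | windowSite x i ∈ frontier U} =
      (fun x : Torus d => x + ∑ l ∈ Finset.univ.filter fun l : Fin k => (l : ℕ) < i, y l) ⁻¹' frontier U := rfl
  change torusHaar d (Prod.mk y ⁻¹' {x : Window d k | windowSite x i ∈ frontier U}) = 0
  rw [this, measure_preimage_add_right]
  exact torusHaar_absolutelyContinuous hU

/-- The product of functions of the increments. -/
noncomputable def incrementProd (Q : Fin k → C(Torus d, ℂ)) : C(Window d k, ℂ) :=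
  ∏ i, (Q i).comp ⟨fun x => x.1 i, by fun_prop⟩

theorem incrementProd_apply (Q : Fin k → C(Torus d, ℂ)) (x : Window d k) :
    incrementProd Q x = ∏ i, Q i (x.1 i) := by
  simp [incrementProd, ContinuousMap.prod_apply]

/-- The characters of the space of windows. -/
noncomputable def windowChar (m : (Fin k → Fin d → ℤ) × (Fin d → ℤ)) : C(Window d k, ℂ) :=
  incrementProd (fun i => torusChar (m.1 i)) * (torusChar m.2).comp ⟨Prod.snd, continuous_snd⟩

theorem windowChar_apply (m : (Fin k → Fin d → ℤ) × (Fin d → ℤ)) (x : Window d k) :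
    windowChar m x = (∏ i, torusChar (m.1 i) (x.1 i)) * torusChar m.2 x.2 := by
  simp [windowChar, incrementProd_apply]

theorem span_windowChar_topologicalClosure_eq_top :
    (Submodule.span ℂ (Set.range (windowChar (d := d) (k := k)))).topologicalClosure = ⊤ := by
  classical
  refine span_range_topologicalClosure_eq_top _ ⟨0, ?_⟩ (fun a b => ⟨a + b, ?_⟩)
    (fun a => ⟨-a, ?_⟩) fun x y h => Prod.ext (funext fun i => eq_of_torusChar_eq fun m => ?_)
      (eq_of_torusChar_eq fun m => ?_)
  · ext x; simp [windowChar_apply]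
  · ext x
    simp only [windowChar_apply, ContinuousMap.mul_apply, Prod.fst_add, Prod.snd_add, Pi.add_apply,
      torusChar_add_index, Finset.prod_mul_distrib]
    ring
  · ext x
    simp only [windowChar_apply, ContinuousMap.star_apply, Prod.fst_neg, Prod.snd_neg, Pi.neg_apply,
      torusChar_neg_index, star_mul', star_prod, RCLike.star_def]
  · have key : ∀ x : Window d k, windowChar (Pi.single i m, 0) x = torusChar m (x.1 i) := by
      intro x
      rw [windowChar_apply, Finset.prod_eq_single i]
      · simp
      · intro j _ hj
        simp [Pi.single_eq_of_ne hj]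
      · simp
    simpa [key] using h (Pi.single i m, 0)
  · simpa [windowChar_apply] using h (0, m)

/-- At the grid lags this value is `windowCharMean`, which identifies the almost sure limits with
integrals against the product density. -/
theorem integral_windowChar_mul_wrappedDensity (v : Fin d → ℝ) {t : Fin k → ℝ} (ht : ∀ i, 0 < t i)
    (m : (Fin k → Fin d → ℤ) × (Fin d → ℤ)) :
    ∫ x, windowChar m x * incrementProd (fun i => wrappedDensity v (t i)) x ∂windowHaar d k =
      if m.2 = 0 then ∏ i, Complex.exp (t i * levyExponent v (m.1 i)) else 0 := by
  have h1 : ∀ x : Window d k,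
      windowChar m x * incrementProd (fun i => wrappedDensity v (t i)) x =
      (∏ i, torusChar (m.1 i) (x.1 i) * wrappedDensity v (t i) (x.1 i)) * torusChar m.2 x.2 := by
    intro x
    rw [windowChar_apply, incrementProd_apply, Finset.prod_mul_distrib]
    ring
  simp only [h1]
  rw [integral_prod_mul (fun y : Fin k → Torus d =>
      ∏ i, torusChar (m.1 i) (y i) * wrappedDensity v (t i) (y i)) (fun x => torusChar m.2 x),
    integral_fintype_prod_eq_prod
      (fun i (y : Torus d) => torusChar (m.1 i) y * wrappedDensity v (t i) y),
    integral_torusChar]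
  simp only [integral_torusChar_mul_wrappedDensity v (ht _)]
  split_ifs <;> simp

/-- The integral of a product of functions of the increments over the windows of a given
pattern. -/
noncomputable def patternIntegral (U : Set (Torus d)) (k : ℕ) (p : Finset ℕ)
    (Q : Fin k → C(Torus d, ℂ)) : ℂ :=
  ∫ x, (windowPattern U k p).indicator 1 x * incrementProd Q x ∂windowHaar d k

theorem exists_patternForm {U : Set (Torus d)} (hU : MeasurableSet U) (k : ℕ) (p : Finset ℕ) :
    ∃ D : ContinuousMultilinearMap ℂ (fun _ : Fin k => C(Torus d, ℂ)) ℂ,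
      ∀ Q, D Q = patternIntegral U k p Q := by
  let R : Fin k → C(Torus d, ℂ) →L[ℂ] C(Window d k, ℂ) := fun i =>
    ⟨(ContinuousMap.compRightAlgHom ℂ ℂ ⟨fun x : Window d k => x.1 i, by fun_prop⟩).toLinearMap,
      ContinuousMap.compRightAlgHom_continuous _ _ _⟩
  refine ⟨(integralMulCLM (windowHaar d k) ((windowPattern U k p).indicator 1)
    (measurable_one.indicator (measurableSet_windowPattern hU p)) (C := 1) fun x => ?_
    ).compContinuousMultilinearMap
      ((ContinuousMultilinearMap.mkPiAlgebra ℂ (Fin k) C(Window d k, ℂ)).compContinuousLinearMap R),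
    fun Q => rfl⟩
  by_cases hx : x ∈ windowPattern U k p <;> simp [hx]

/-- The trace yields pattern integrals only for densities at grid lags. These span a dense subspace
in each slot, so the difference of the two multilinear forms vanishes. -/
theorem patternIntegral_eq_of_wrappedDensity {v : Fin d → ℝ} {h : ℝ} (hh : 0 < h)
    (hinj : Function.Injective fun m : Fin d → ℤ => Complex.exp (h * levyExponent v m))
    {U V : Set (Torus d)} (hU : MeasurableSet U) (hV : MeasurableSet V) (p : Finset ℕ)
    (hUV : ∀ n : Fin k → ℕ,
      patternIntegral U k p (fun i => wrappedDensity v (((n i + 1 : ℕ) : ℝ) * h)) =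
      patternIntegral V k p (fun i => wrappedDensity v (((n i + 1 : ℕ) : ℝ) * h)))
    (Q : Fin k → C(Torus d, ℂ)) : patternIntegral U k p Q = patternIntegral V k p Q := by
  obtain ⟨D, hD⟩ := exists_patternForm hU k p
  obtain ⟨D', hD'⟩ := exists_patternForm hV k p
  rw [← hD, ← hD', ← sub_eq_zero]
  refine (D - D').eq_zero_of_span_dense (span_wrappedDensity_topologicalClosure_eq_top hh hinj)
    (fun Q hQ => ?_) Q
  choose n hn using hQ
  have : Q = fun i => wrappedDensity v (((n i + 1 : ℕ) : ℝ) * h) := funext fun i => (hn i).symm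
  rw [this, _root_.sub_apply, hD, hD', hUV, sub_self]

/-- If the pattern integrals of two sets agree, then the pattern of one along a path is matched by
the other along a nearby path. -/
theorem exists_mem_windowPattern_of_patternIntegral_eq {U V : Set (Torus d)}
    (hU : MeasurableSet U)
    {p : Finset ℕ} (hUV : ∀ Q, patternIntegral U k p Q = patternIntegral V k p Q)
    {x : Window d k} (hx : x ∈ windowPattern U k p) (hfr : ∀ i ≤ k, windowSite x i ∉ frontier U)
    {ε : ℝ} (hε : 0 < ε) :
    ∃ y ∈ windowPattern V k p, ∀ i, dist (y.1 i) (x.1 i) < ε := by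
  by_contra! hcon
  -- Tents supported in the `ε`-balls around the increments of `x` make the integral for `V` vanish.
  -- Near `x` the pattern of `U` is locally constant and the tents are positive, so the integral for
  -- `U` is positive. The starting point stays free, which is the source of the unknown shift.
  let b : Fin k → Torus d → ℝ := fun i y => max 0 (ε - dist y (x.1 i))
  have hb0 : ∀ i y, 0 ≤ b i y := fun i y => le_max_left _ _
  have hbc : ∀ i, Continuous (b i) := fun i => by fun_prop
  let Q : Fin k → C(Torus d, ℂ) := fun i => ⟨fun y => (b i y : ℂ), by fun_prop⟩
  have hV0 : patternIntegral V k p Q = 0 := by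
    unfold patternIntegral
    refine integral_eq_zero_of_ae (Eventually.of_forall fun y => ?_)
    by_cases hy : y ∈ windowPattern V k p
    · obtain ⟨i, hi⟩ := hcon y hy
      have : Q i (y.1 i) = 0 := by
        change ((max 0 (ε - dist (y.1 i) (x.1 i)) : ℝ) : ℂ) = 0
        rw [max_eq_left (sub_nonpos.2 hi), Complex.ofReal_zero]
      simp only [Pi.zero_apply]
      rw [incrementProd_apply, Finset.prod_eq_zero (Finset.mem_univ i) this, mul_zero]
    · simp [hy]
  let g : Window d k → ℝ := (windowPattern U k p).indicator fun y => ∏ i, b i (y.1 i)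
  have hUg : patternIntegral U k p Q = ((∫ y, g y ∂windowHaar d k : ℝ) : ℂ) := by
    rw [← integral_complex_ofReal]
    unfold patternIntegral
    congr 1 with y
    rw [incrementProd_apply]
    by_cases hy : y ∈ windowPattern U k p <;> simp [g, hy, Q]
  have hcont : Continuous fun y : Window d k => ∏ i, b i (y.1 i) :=
    continuous_finsetProd _ fun i _ => (hbc i).comp (by fun_prop)
  have hpos : 0 < ∫ y, g y ∂windowHaar d k := by
    rw [integral_pos_iff_support_of_nonneg]
    · have hnhds : Function.support g ∈ 𝓝 x := by
        have h1 : ∀ᶠ y in 𝓝 x, 0 < ∏ i, b i (y.1 i) := by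
          refine hcont.continuousAt.eventually_const_lt (Finset.prod_pos fun i _ => ?_)
          simp [b, hε]
        filter_upwards [windowPattern_mem_nhds hx hfr, h1] with y hy hy1
        rw [Function.mem_support]
        simp only [g, Set.indicator_of_mem hy]
        exact hy1.ne'
      exact Measure.measure_pos_of_mem_nhds _ hnhds
    · intro y
      exact Set.indicator_nonneg (fun y _ => Finset.prod_nonneg fun i _ => hb0 _ _) y
    · exact (hcont.integrable_of_hasCompactSupport (HasCompactSupport.of_compactSpace _)).indicator
        (measurableSet_windowPattern hU p)
  rw [hUV, hV0] at hUg
  exact hpos.ne (by exact_mod_cast hUg)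

end Window

/-! ### From shadowed patterns to a translation. -/

section Shift

variable {d : ℕ}

/-- If every path avoiding the boundary of `U` is shadowed by a translate whose pattern along `V`
is the same, then `V` is a translate of `U` up to the boundaries. -/
theorem exists_shift_of_shadowing {G : Type*} [AddCommGroup G] [MetricSpace G] [CompactSpace G]
    [ContinuousAdd G] {U V : Set G} (hU : IsOpen U) (hV : IsOpen V)
    (H : ∀ u : ℕ → G, (∀ i, u i ∉ frontier U) → ∀ k : ℕ, ∀ ε > 0, ∃ θ : G, ∃ y : ℕ → G,
      ∀ i ≤ k, dist (y i) (u i) < ε ∧ (y i + θ ∈ V ↔ u i ∈ U)) :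
    ∃ θ : G, ∀ x, x ∉ frontier U → x + θ ∉ frontier V → (x + θ ∈ V ↔ x ∈ U) := by
  -- The frontier of an open set has empty interior, so a sequence off the frontier can be dense.
  have hden : Dense (frontier U)ᶜ := by
    rw [← interior_eq_empty_iff_dense_compl, ← frontier_compl]
    exact interior_frontier hU.isClosed_compl
  have : Nonempty ((frontier U)ᶜ : Set G) := hden.nonempty.to_subtype
  let u : ℕ → G := fun i => (TopologicalSpace.denseSeq ((frontier U)ᶜ : Set G) i : G)
  have hu : ∀ i, u i ∉ frontier U := fun i => (TopologicalSpace.denseSeq ((frontier U)ᶜ : Set G) i).2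
  have hud : ∀ O : Set G, IsOpen O → O.Nonempty → O ⊆ (frontier U)ᶜ → ∃ i, u i ∈ O := by
    rintro O hO ⟨x, hx⟩ hOs
    obtain ⟨i, hi⟩ := (TopologicalSpace.denseRange_denseSeq ((frontier U)ᶜ : Set G)).exists_mem_open
      (hO.preimage continuous_subtype_val) ⟨⟨x, hOs hx⟩, hx⟩
    exact ⟨i, hi⟩
  -- Stage `n` shadows the first `n + 1` points within `1 / (n + 1)`; the shift sought is a limit
  -- point of the `θ n`.
  choose θ y hy using fun n : ℕ => H u hu n (1 / ((n : ℝ) + 1)) Nat.one_div_pos_of_nat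
  obtain ⟨θ₀, -, φ, hφ, hθ⟩ := isCompact_univ.tendsto_subseq fun n => Set.mem_univ (θ n)
  have hlim : ∀ i, Tendsto (fun n => y (φ n) i + θ (φ n)) atTop (𝓝 (u i + θ₀)) := by
    intro i
    refine Tendsto.add ?_ hθ
    have h0 : Tendsto (fun n => y n i) atTop (𝓝 (u i)) := by
      rw [tendsto_iff_dist_tendsto_zero]
      refine squeeze_zero' (Eventually.of_forall fun _ => dist_nonneg) ?_
        (tendsto_one_div_add_atTop_nhds_zero_nat (𝕜 := ℝ))
      filter_upwards [eventually_ge_atTop i] with n hn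
      exact (hy n i hn).1.le
    exact h0.comp hφ.tendsto_atTop
  have hpat : ∀ i, ∀ᶠ n in atTop, (y (φ n) i + θ (φ n) ∈ V ↔ u i ∈ U) := by
    intro i
    filter_upwards [eventually_ge_atTop i] with n hn
    exact (hy (φ n) i (hn.trans (hφ.id_le n))).2
  -- Limits preserve only closed conditions. Off both frontiers a disagreement at `x` would persist
  -- on an open set, which contains some `u i` and contradicts `hin` or `hout`.
  have hin : ∀ i, u i ∈ U → u i + θ₀ ∈ closure V := fun i hi =>
    mem_closure_of_tendsto (hlim i) ((hpat i).mono fun n hn => hn.2 hi)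
  have hout : ∀ i, u i ∉ U → u i + θ₀ ∉ V := fun i hi =>
    hV.isClosed_compl.mem_of_tendsto (hlim i) ((hpat i).mono fun n hn h => hi (hn.1 h))
  have hadd : Continuous fun x : G => x + θ₀ := continuous_add_const θ₀
  refine ⟨θ₀, fun x hx hxV => ⟨fun h => ?_, fun h => ?_⟩⟩
  · by_contra hxU
    have hxc : x ∈ (closure U)ᶜ := fun hc => hx ⟨hc, fun hi => hxU (interior_subset hi)⟩
    obtain ⟨i, hi⟩ := hud ((closure U)ᶜ ∩ (fun x => x + θ₀) ⁻¹' V)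
      (isClosed_closure.isOpen_compl.inter (hV.preimage hadd)) ⟨x, hxc, h⟩
      fun z hz hf => hz.1 hf.1
    exact hout i (fun hiU => hi.1 (subset_closure hiU)) hi.2
  · by_contra hxV'
    have hxc : x + θ₀ ∈ (closure V)ᶜ := fun hc =>
      hxV ⟨hc, fun hi => hxV' (interior_subset hi)⟩
    obtain ⟨i, hi⟩ := hud (U ∩ (fun x => x + θ₀) ⁻¹' (closure V)ᶜ)
      (hU.inter (isClosed_closure.isOpen_compl.preimage hadd)) ⟨x, h, hxc⟩
      fun z hz hf => hf.2 (by rw [hU.interior_eq]; exact hz.1)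
    exact hi.2 (hin i hi.1)

theorem exists_shift_of_patternIntegral_eq {U V : Set (Torus d)} (hU : IsOpen U) (hV : IsOpen V)
    (hUV : ∀ (k : ℕ) (p : Finset ℕ) (Q : Fin k → C(Torus d, ℂ)),
      patternIntegral U k p Q = patternIntegral V k p Q) :
    ∃ θ : Torus d, ∀ x, x ∉ frontier U → x + θ ∉ frontier V → (x + θ ∈ V ↔ x ∈ U) := by
  classical
  refine exists_shift_of_shadowing hU hV fun u hu k ε hε => ?_
  let p : Finset ℕ := (Finset.range (k + 1)).filter fun i => u i ∈ U
  let x : Window d k := (fun l : Fin k => u (l + 1) - u l, u 0)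
  have hxs : ∀ i ≤ k, windowSite x i = u i := fun i hi => windowSite_path u hi
  have hp : ∀ i ≤ k, (i ∈ p ↔ u i ∈ U) := fun i hi => by simp [p, hi]
  obtain ⟨y, hy, hyx⟩ := exists_mem_windowPattern_of_patternIntegral_eq (x := x) hU.measurableSet
    (hUV k p) (fun i hi => by rw [hxs i hi, hp i hi]) (fun i hi => by rw [hxs i hi]; exact hu i)
    -- At most `k` increment errors accumulate at a site once the two starting points are aligned,
    -- for a total below `ε`.
    (show 0 < ε / (k + 1) by positivity)
  refine ⟨y.2 - u 0, fun i => windowSite y i - (y.2 - u 0), fun i hi => ⟨?_, ?_⟩⟩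
  · have h1 : windowSite y i - (y.2 - u 0) - u i =
        ∑ l ∈ Finset.univ.filter fun l : Fin k => (l : ℕ) < i, (y.1 l - x.1 l) := by
      rw [← hxs i hi, Finset.sum_sub_distrib]
      change windowSite y i - (y.2 - x.2) - windowSite x i = _
      unfold windowSite
      abel
    rw [dist_eq_norm, h1]
    calc ‖∑ l ∈ Finset.univ.filter fun l : Fin k => (l : ℕ) < i, (y.1 l - x.1 l)‖
        ≤ ∑ l ∈ Finset.univ.filter fun l : Fin k => (l : ℕ) < i, ε / (k + 1) :=
          norm_sum_le_of_le _ fun l _ => by rw [← dist_eq_norm]; exact (hyx l).le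
      _ ≤ ∑ _l : Fin k, ε / (k + 1) :=
          Finset.sum_le_sum_of_subset_of_nonneg (Finset.filter_subset _ _)
            fun _ _ _ => by positivity
      _ = k * (ε / (k + 1)) := by simp
      _ < (k + 1) * (ε / (k + 1)) := by
          have : 0 < ε / (k + 1) := by positivity
          linarith
      _ = ε := by field_simp
  · rw [sub_add_cancel, hy i hi, hp i hi]

/-- Two open sets with null boundaries and the same pattern integrals agree up to translation and a
null set. -/
theorem exists_ae_indicator_eq_of_patternIntegral_eq {U V : Set (Torus d)} (hU : IsOpen U)
    (hV : IsOpen V) (hU0 : volume (frontier U) = 0) (hV0 : volume (frontier V) = 0)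
    (hUV : ∀ (k : ℕ) (p : Finset ℕ) (Q : Fin k → C(Torus d, ℂ)),
      patternIntegral U k p Q = patternIntegral V k p Q) :
    ∃ θ : Torus d, ∀ᵐ x : Torus d, U.indicator (1 : Torus d → ℝ) x = V.indicator 1 (x + θ) := by
  obtain ⟨θ, hθ⟩ := exists_shift_of_patternIntegral_eq hU hV hUV
  refine ⟨θ, ?_⟩
  have h1 : ∀ᵐ x : Torus d, x ∉ frontier U := measure_eq_zero_iff_ae_notMem.1 hU0
  have h2 : ∀ᵐ x : Torus d, x + θ ∉ frontier V := by
    have h0 : volume ((fun x : Torus d => x + θ) ⁻¹' frontier V) = 0 := by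
      rw [measure_preimage_add_right, hV0]
    exact measure_eq_zero_iff_ae_notMem.1 h0
  filter_upwards [h1, h2] with x hx hx'
  by_cases h : x ∈ U
  · simp [h, (hθ x hx hx').2 h]
  · have : x + θ ∉ V := fun h' => h ((hθ x hx hx').1 h')
    simp [h, this]

end Shift

/-! ### Sampling times and the algebra of correlations between windows. -/

section Sampling

variable {d k : ℕ}

/-- The grid position of the `i`-th site of a window with lags `n l + 1`. -/
def sampleOffset (n : Fin k → ℕ) (i : ℕ) : ℕ :=
  ∑ l ∈ Finset.univ.filter fun l : Fin k => (l : ℕ) < i, (n l + 1)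

theorem monotone_sampleOffset (n : Fin k → ℕ) : Monotone (sampleOffset n) := by
  intro i j hij
  refine Finset.sum_le_sum_of_subset fun l hl => ?_
  simp only [Finset.mem_filter, Finset.mem_univ, true_and] at hl ⊢
  omega

@[simp] theorem sampleOffset_zero (n : Fin k → ℕ) : sampleOffset n 0 = 0 := by
  simp [sampleOffset]

theorem sampleOffset_succ (n : Fin k → ℕ) (l : Fin k) :
    sampleOffset n (l + 1) = sampleOffset n l + (n l + 1) := by
  unfold sampleOffset
  have : (Finset.univ.filter fun l' : Fin k => (l' : ℕ) < l + 1) =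
      insert l (Finset.univ.filter fun l' : Fin k => (l' : ℕ) < l) := by
    ext l'
    simp only [Finset.mem_filter, Finset.mem_univ, true_and, Finset.mem_insert, Fin.ext_iff]
    omega
  rw [this, Finset.sum_insert (by simp), add_comm]

/-- The time of the `i`-th site of the `j`-th window with lags `n l + 1` on the grid of mesh `h`.
Distinct windows are disjoint. -/
noncomputable def sampleTime (h : ℝ≥0) (n : Fin k → ℕ) (j i : ℕ) : ℝ≥0 :=
  ((j * (sampleOffset n k + 1) + sampleOffset n i : ℕ) : ℝ≥0) * h

theorem monotone_sampleTime (h : ℝ≥0) (n : Fin k → ℕ) (j : ℕ) : Monotone (sampleTime h n j) := by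
  intro i i' hi
  unfold sampleTime
  have := monotone_sampleOffset n hi
  gcongr

theorem sampleTime_succ_sub (h : ℝ≥0) (n : Fin k → ℕ) (j : ℕ) (l : Fin k) :
    sampleTime h n j (l + 1) - sampleTime h n j l = ((n l + 1 : ℕ) : ℝ≥0) * h := by
  unfold sampleTime
  rw [sampleOffset_succ, ← add_assoc, Nat.cast_add, add_mul, add_tsub_cancel_left]

/-- The extra 1 in the stride of `sampleTime` leaves a gap between windows that grows at least
linearly in `l - j`; correlations decay across it. -/
theorem exists_sampleTime_sub (h : ℝ≥0) (n : Fin k → ℕ) {j l : ℕ} (hjl : j < l) :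
    ∃ g : ℕ, l - j ≤ g ∧ sampleTime h n l 0 = sampleTime h n j k + (g : ℝ≥0) * h := by
  obtain ⟨q, rfl⟩ := Nat.exists_eq_add_of_lt hjl
  refine ⟨q * sampleOffset n k + q + 1, ?_, ?_⟩
  · have := Nat.zero_le (q * sampleOffset n k)
    omega
  · unfold sampleTime
    rw [← add_mul, ← Nat.cast_add, sampleOffset_zero]
    congr 2
    ring

/-- The `j`-th window of a path. -/
noncomputable def sampleWindow (h : ℝ≥0) (n : Fin k → ℕ) (x : ℝ≥0 → Torus d) (j : ℕ) :
    Window d k :=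
  (fun l => x (sampleTime h n j (l + 1)) - x (sampleTime h n j l), x (sampleTime h n j 0))

theorem windowSite_sampleWindow (h : ℝ≥0) (n : Fin k → ℕ) (x : ℝ≥0 → Torus d) (j : ℕ) {i : ℕ}
    (hi : i ≤ k) : windowSite (sampleWindow h n x j) i = x (sampleTime h n j i) :=
  windowSite_path (fun i => x (sampleTime h n j i)) hi

/-- The starting points enter only through `y 0 - x 0`, which is the gap `y 0 - x k` plus the
increments of `x`; hence the twist by `-m`. The result involves increments only, so the law of `X 0`
never matters. -/
theorem prod_torusChar_mul_conj (M : ℕ → Fin d → ℤ) (m : Fin d → ℤ) (x y : ℕ → Torus d) :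
    (∏ i ∈ Finset.range k, torusChar (M i) (x (i + 1) - x i)) * torusChar m (x 0) *
      conj ((∏ i ∈ Finset.range k, torusChar (M i) (y (i + 1) - y i)) * torusChar m (y 0)) =
    (∏ i ∈ Finset.range k, torusChar (M i - m) (x (i + 1) - x i)) * torusChar (-m) (y 0 - x k) *
      ∏ i ∈ Finset.range k, torusChar (-M i) (y (i + 1) - y i) := by
  simp only [sub_eq_add_neg (M _) m, torusChar_add_index, Finset.prod_mul_distrib]
  rw [← torusChar_sum, Finset.sum_range_sub]
  simp only [torusChar_neg_index, torusChar_sub, map_mul, map_prod, Complex.conj_conj]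
  have h := torusChar_mul_conj m (x k)
  linear_combination (-(∏ i ∈ Finset.range k, torusChar (M i) (x (i + 1)) * conj (torusChar (M i) (x i))) *
    torusChar m (x 0) * conj (torusChar m (y 0)) *
    ∏ i ∈ Finset.range k, conj (torusChar (M i) (y (i + 1))) * torusChar (M i) (y i)) * h

theorem conj_exp_mul_levyExponent (v : Fin d → ℝ) (t : ℝ) (m : Fin d → ℤ) :
    conj (Complex.exp (t * levyExponent v m)) = Complex.exp (t * levyExponent v (-m)) := by
  rw [← Complex.exp_conj, map_mul, Complex.conj_ofReal, levyExponent, levyExponent, map_sum]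
  congr 2
  refine Finset.sum_congr rfl fun i _ => ?_
  simp only [map_sub, map_mul, map_div₀, map_pow, Complex.conj_I, Complex.conj_ofReal, Pi.neg_apply,
    map_intCast, map_ofNat]
  push_cast
  ring

theorem norm_exp_mul_levyExponent_le_one (v : Fin d → ℝ) {t : ℝ} (ht : 0 ≤ t) (m : Fin d → ℤ) :
    ‖Complex.exp (t * levyExponent v m)‖ ≤ 1 := by
  rw [norm_exp_mul_levyExponent]
  exact Finset.prod_le_one (fun i _ => (Real.exp_pos _).le) fun i _ => Real.exp_le_one_iff.2
    (mul_nonpos_of_nonpos_of_nonneg (neg_nonpos.2 (div_nonneg ht zero_le_two)) (sq_nonneg _))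

end Sampling

/-! ### Almost sure pattern frequencies along the Brownian path. -/

section BrownianMotion

variable {d k : ℕ} {Ω : Type*} [MeasurableSpace Ω] {P : Measure Ω} {v : Fin d → ℝ}
  {X : ℝ≥0 → Ω → Torus d}

theorem IsTorusBrownianMotion.integral_torusChar_increment (hX : IsTorusBrownianMotion v X P)
    {s t : ℝ≥0} (hst : s ≤ t) (m : Fin d → ℤ) :
    ∫ ω, torusChar m (X t ω - X s ω) ∂P = Complex.exp (((t - s : ℝ≥0) : ℝ) * levyExponent v m) := by
  have h := hX.hasLaw_increment s (t - s)
  rw [add_tsub_cancel_of_le hst] at h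
  rw [← integral_map (f := torusChar m) h.aemeasurable
    (torusChar m).continuous.aestronglyMeasurable, h.map_eq, integral_torusChar_wrappedGaussian]

theorem IsTorusBrownianMotion.integral_prod_torusChar_increment
    (hX : IsTorusBrownianMotion v X P) {u : ℕ → ℝ≥0} (hu : Monotone u) (N : ℕ)
    (r : ℕ → Fin d → ℤ) :
    ∫ ω, ∏ i ∈ Finset.range N, torusChar (r i) (X (u (i + 1)) ω - X (u i) ω) ∂P =
      ∏ i ∈ Finset.range N,
        Complex.exp (((u (i + 1) - u i : ℝ≥0) : ℝ) * levyExponent v (r i)) := by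
  have hind : iIndepFun (fun (i : Fin N) ω => X (u (i + 1)) ω - X (u i) ω) P :=
    (hX.hasIndepIncrements.nat hu).precomp Fin.val_injective
  have hm : ∀ i : Fin N, AEMeasurable (fun ω => X (u (i + 1)) ω - X (u i) ω) P := fun i => by
    have h := (hX.hasLaw_increment (u i) (u (i + 1) - u i)).aemeasurable
    rwa [add_tsub_cancel_of_le (hu (Nat.le_succ _))] at h
  have h := hind.integral_fun_prod_comp (f := fun (i : Fin N) x => torusChar (r i) x) hm
    fun i => (torusChar (r i)).continuous.aestronglyMeasurable
  simp only [Finset.prod_range]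
  refine h.trans (Finset.prod_congr rfl fun i _ => ?_)
  exact hX.integral_torusChar_increment (hu (Nat.le_succ _)) _

theorem windowChar_sampleWindow (h : ℝ≥0) (n : Fin k → ℕ) (x : ℝ≥0 → Torus d) (j : ℕ)
    {m : (Fin k → Fin d → ℤ) × (Fin d → ℤ)} {M : ℕ → Fin d → ℤ} (hM : ∀ i : Fin k, M i = m.1 i) :
    windowChar m (sampleWindow h n x j) =
      (∏ i ∈ Finset.range k, torusChar (M i)
        (x (sampleTime h n j (i + 1)) - x (sampleTime h n j i))) *
        torusChar m.2 (x (sampleTime h n j 0)) := by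
  rw [windowChar_apply, Finset.prod_range]
  simp only [hM]
  rfl

/-- The limit of the averages of a character over the windows. -/
noncomputable def windowCharMean (v : Fin d → ℝ) (h : ℝ≥0) (n : Fin k → ℕ)
    (m : (Fin k → Fin d → ℤ) × (Fin d → ℤ)) : ℂ :=
  if m.2 = 0 then ∏ i, Complex.exp ((((n i + 1 : ℕ) : ℝ) * h : ℝ) * levyExponent v (m.1 i)) else 0

theorem IsTorusBrownianMotion.integral_windowChar (hX : IsTorusBrownianMotion v X P) (h : ℝ≥0)
    (n : Fin k → ℕ) (j : ℕ) {m : (Fin k → Fin d → ℤ) × (Fin d → ℤ)} (hm : m.2 = 0) :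
    ∫ ω, windowChar m (sampleWindow h n (fun t => X t ω) j) ∂P = windowCharMean v h n m := by
  let M : ℕ → Fin d → ℤ := fun i => if hi : i < k then m.1 ⟨i, hi⟩ else 0
  have hM : ∀ i : Fin k, M i = m.1 i := fun i => by simp [M]
  simp only [windowChar_sampleWindow h n _ j hM, hm, torusChar_zero_index, mul_one]
  rw [hX.integral_prod_torusChar_increment (monotone_sampleTime h n j), Finset.prod_range,
    windowCharMean, if_pos hm]
  refine Finset.prod_congr rfl fun i _ => ?_
  rw [sampleTime_succ_sub, hM]
  push_cast
  rfl

theorem IsTorusBrownianMotion.integral_windowChar_mul_conj (hX : IsTorusBrownianMotion v X P)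
    (h : ℝ≥0) (n : Fin k → ℕ) {j l : ℕ} (hjl : j < l) (m : (Fin k → Fin d → ℤ) × (Fin d → ℤ)) :
    ∃ g : ℕ, l - j ≤ g ∧
    ∫ ω, windowChar m (sampleWindow h n (fun t => X t ω) j) *
        conj (windowChar m (sampleWindow h n (fun t => X t ω) l)) ∂P =
      (∏ i, Complex.exp ((((n i + 1 : ℕ) : ℝ) * h : ℝ) * levyExponent v (m.1 i - m.2))) *
      Complex.exp (((g : ℝ) * h : ℝ) * levyExponent v (-m.2)) *
      ∏ i, Complex.exp ((((n i + 1 : ℕ) : ℝ) * h : ℝ) * levyExponent v (-m.1 i)) := by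
  obtain ⟨g, hg, hgap⟩ := exists_sampleTime_sub h n hjl
  refine ⟨g, hg, ?_⟩
  let M : ℕ → Fin d → ℤ := fun i => if hi : i < k then m.1 ⟨i, hi⟩ else 0
  have hM : ∀ i : Fin k, M i = m.1 i := fun i => by simp [M]
  -- The times of both windows in one monotone sequence: `k` increments, the gap, then `k` more,
  -- with matching frequencies `r`.
  let u : ℕ → ℝ≥0 := fun i =>
    if i ≤ k then sampleTime h n j i else sampleTime h n l (i - (k + 1))
  have hu1 : ∀ i ≤ k, u i = sampleTime h n j i := fun i hi => if_pos hi
  have hu2 : ∀ i, u (k + 1 + i) = sampleTime h n l i := fun i => by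
    simp only [u]
    rw [if_neg (by omega), Nat.add_sub_cancel_left]
  have hu : Monotone u := by
    refine monotone_nat_of_le_succ fun i => ?_
    rcases lt_trichotomy i k with hi | rfl | hi
    · rw [hu1 i hi.le, hu1 (i + 1) hi]
      exact monotone_sampleTime h n j (Nat.le_succ i)
    · rw [hu1 i le_rfl, ← add_zero (i + 1), hu2, hgap]
      exact le_self_add
    · obtain ⟨q, rfl⟩ := Nat.exists_eq_add_of_lt hi
      rw [show k + q + 1 = k + 1 + q by ring, hu2, add_assoc, hu2]
      exact monotone_sampleTime h n l (Nat.le_succ q)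
  let r : ℕ → Fin d → ℤ := fun i =>
    if i < k then M i - m.2 else if i = k then -m.2 else -M (i - (k + 1))
  have hr1 : ∀ i < k, r i = M i - m.2 := fun i hi => if_pos hi
  have hr2 : r k = -m.2 := by simp [r]
  have hr3 : ∀ i, r (k + 1 + i) = -M i := fun i => by
    simp only [r]
    rw [if_neg (by omega), if_neg (by omega), Nat.add_sub_cancel_left]
  -- Stated for general `F` so as to split both the random product and the product of its
  -- expectations.
  have hsplit : ∀ F : (Fin d → ℤ) → ℝ≥0 → ℝ≥0 → ℂ,
      ∏ i ∈ Finset.range (k + 1 + k), F (r i) (u (i + 1)) (u i) =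
      (∏ i ∈ Finset.range k, F (M i - m.2) (sampleTime h n j (i + 1)) (sampleTime h n j i)) *
      F (-m.2) (sampleTime h n l 0) (sampleTime h n j k) *
      ∏ i ∈ Finset.range k, F (-M i) (sampleTime h n l (i + 1)) (sampleTime h n l i) := by
    intro F
    rw [Finset.prod_range_add, Finset.prod_range_succ, hr2, hu1 k le_rfl,
      show u (k + 1) = sampleTime h n l 0 from hu2 0]
    congr 2
    · refine Finset.prod_congr rfl fun i hi => ?_
      have hi := Finset.mem_range.1 hi
      rw [hr1 i hi, hu1 i hi.le, hu1 (i + 1) hi]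
    · funext i
      rw [hr3, hu2, add_assoc, hu2]
  have hL := hX.integral_prod_torusChar_increment hu (k + 1 + k) r
  have e1 := fun ω => hsplit fun m s t => torusChar m (X s ω - X t ω)
  have e2 := hsplit fun m s t => Complex.exp (((s - t : ℝ≥0) : ℝ) * levyExponent v m)
  simp only [e1, e2] at hL
  have e3 : ∀ ω, windowChar m (sampleWindow h n (fun t => X t ω) j) *
        conj (windowChar m (sampleWindow h n (fun t => X t ω) l)) = _ := fun ω =>
    (congrArg₂ (fun a b => a * conj b) (windowChar_sampleWindow h n (fun t => X t ω) j hM)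
      (windowChar_sampleWindow h n (fun t => X t ω) l hM)).trans
      (prod_torusChar_mul_conj M m.2 (fun i => X (sampleTime h n j i) ω)
        fun i => X (sampleTime h n l i) ω)
  simp only [e3]
  rw [hL]
  simp only [Finset.prod_range, sampleTime_succ_sub, hM]
  rw [hgap, add_tsub_cancel_left]
  push_cast
  rfl

theorem norm_windowChar_apply (m : (Fin k → Fin d → ℤ) × (Fin d → ℤ)) (x : Window d k) :
    ‖windowChar m x‖ = 1 := by
  rw [windowChar_apply, norm_mul, norm_prod]
  simp

theorem norm_windowCharMean_le (v : Fin d → ℝ) (h : ℝ≥0) (n : Fin k → ℕ)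
    (m : (Fin k → Fin d → ℤ) × (Fin d → ℤ)) : ‖windowCharMean v h n m‖ ≤ 1 := by
  unfold windowCharMean
  split_ifs
  · rw [norm_prod]
    exact Finset.prod_le_one (fun _ _ => norm_nonneg _)
      fun i _ => norm_exp_mul_levyExponent_le_one v (by positivity) _
  · simp

theorem IsTorusBrownianMotion.aestronglyMeasurable_windowChar (hX : IsTorusBrownianMotion v X P)
    (h : ℝ≥0) (n : Fin k → ℕ) (j : ℕ) (m : (Fin k → Fin d → ℤ) × (Fin d → ℤ)) :
    AEStronglyMeasurable (fun ω => windowChar m (sampleWindow h n (fun t => X t ω) j)) P := by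
  have hZ : AEMeasurable (fun ω => sampleWindow h n (fun t => X t ω) j) P :=
    (aemeasurable_pi_lambda _ fun l => (hX.aemeasurable _).sub (hX.aemeasurable _)).prodMk
      (hX.aemeasurable _)
  exact ((windowChar m).continuous.measurable.comp_aemeasurable hZ).aestronglyMeasurable

theorem IsTorusBrownianMotion.ae_tendsto_windowChar [IsProbabilityMeasure P]
    (hX : IsTorusBrownianMotion v X P) {h : ℝ≥0} (hh : 0 < h) (n : Fin k → ℕ)
    (m : (Fin k → Fin d → ℤ) × (Fin d → ℤ)) :
    ∀ᵐ ω ∂P, Tendsto (sqAvg fun j => windowChar m (sampleWindow h n (fun t => X t ω) j)) atTop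
      (𝓝 (windowCharMean v h n m)) := by
  set c := windowCharMean v h n m with hc
  let χ : ℕ → Ω → ℂ := fun j ω => windowChar m (sampleWindow h n (fun t => X t ω) j)
  have hχm : ∀ j, AEStronglyMeasurable (χ j) P := fun j =>
    hX.aestronglyMeasurable_windowChar h n j m
  have hχ1 : ∀ j ω, ‖χ j ω‖ = 1 := fun j ω => norm_windowChar_apply _ _
  have hχi : ∀ j, Integrable (χ j) P := fun j =>
    Integrable.of_bound (hχm j) 1 (Eventually.of_forall fun ω => (hχ1 j ω).le)
  have hχc : ∀ j, Integrable (fun ω => conj (χ j ω)) P := fun j =>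
    Integrable.of_bound (Complex.continuous_conj.comp_aestronglyMeasurable (hχm j)) 1
      (Eventually.of_forall fun ω => by rw [RCLike.norm_conj]; exact (hχ1 j ω).le)
  have hχχ : ∀ j l, Integrable (fun ω => χ j ω * conj (χ l ω)) P := fun j l =>
    Integrable.of_bound
      ((hχm j).mul (Complex.continuous_conj.comp_aestronglyMeasurable (hχm l))) 1
      (Eventually.of_forall fun ω => by rw [norm_mul, RCLike.norm_conj, hχ1, hχ1, one_mul])
  obtain ⟨ρ, hρ0, hρ1, hcov⟩ : ∃ ρ : ℝ, 0 ≤ ρ ∧ ρ < 1 ∧ ∀ j l, j < l →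
      ‖∫ ω, (χ j ω - c) * conj (χ l ω - c) ∂P‖ ≤ ρ ^ (l - j) := by
    -- If `m.2 = 0`, the characters see disjoint increments and the covariance is 0. Otherwise the
    -- mean `c` is replaced by 0 and the gap factor gives the rate `‖exp (h * levyExponent v
    -- (-m.2))‖ < 1`.
    by_cases hm : m.2 = 0
    · refine ⟨0, le_rfl, zero_lt_one, fun j l hjl => ?_⟩
      obtain ⟨g, -, hjl'⟩ := hX.integral_windowChar_mul_conj h n hjl m
      have hmean : ∀ j, ∫ ω, χ j ω ∂P = c := fun j => hX.integral_windowChar h n j hm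
      have h0 : levyExponent v (0 : Fin d → ℤ) = 0 := by simp [levyExponent]
      have hcc : ∫ ω, χ j ω * conj (χ l ω) ∂P = c * conj c := by
        refine hjl'.trans ?_
        rw [hc, windowCharMean, if_pos hm, hm, neg_zero, h0, mul_zero, Complex.exp_zero, mul_one,
          map_prod]
        simp only [sub_zero, conj_exp_mul_levyExponent]
      have hexp : ∀ ω, (χ j ω - c) * conj (χ l ω - c) =
          χ j ω * conj (χ l ω) - χ j ω * conj c - (c * conj (χ l ω) - c * conj c) := fun ω => by
        rw [map_sub]; ring
      have hz : ∫ ω, (χ j ω - c) * conj (χ l ω - c) ∂P = 0 := by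
        simp only [hexp]
        have i1 : Integrable (fun ω => χ j ω * conj c) P := (hχi j).mul_const _
        have i2 : Integrable (fun ω => c * conj (χ l ω)) P := (hχc l).const_mul _
        have i3 : Integrable (fun ω => χ j ω * conj (χ l ω) - χ j ω * conj c) P := (hχχ j l).sub i1
        have i4 : Integrable (fun ω => c * conj (χ l ω) - c * conj c) P :=
          i2.sub (integrable_const _)
        rw [integral_sub i3 i4, integral_sub (hχχ j l) i1, integral_sub i2 (integrable_const _),
          integral_mul_const, integral_const_mul, integral_conj, hmean, hmean, hcc]
        simp
      rw [hz, norm_zero]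
      exact pow_nonneg le_rfl _
    · have hc0 : c = 0 := if_neg hm
      refine ⟨_, norm_nonneg _, norm_exp_mul_levyExponent_lt_one v (t := h) hh
        (neg_ne_zero.2 hm), fun j l hjl => ?_⟩
      obtain ⟨g, hg, hjl'⟩ := hX.integral_windowChar_mul_conj h n hjl m
      simp only [hc0, sub_zero]
      rw [hjl', norm_mul, norm_mul, norm_prod, norm_prod]
      have hle : ∀ M : Fin k → Fin d → ℤ, ∏ i, ‖Complex.exp
          ((((n i + 1 : ℕ) : ℝ) * h : ℝ) * levyExponent v (M i))‖ ≤ 1 := fun M =>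
        Finset.prod_le_one (fun _ _ => norm_nonneg _)
          fun i _ => norm_exp_mul_levyExponent_le_one v (by positivity) _
      have hgap : ‖Complex.exp (((g : ℝ) * h : ℝ) * levyExponent v (-m.2))‖ ≤
          ‖Complex.exp ((h : ℝ) * levyExponent v (-m.2))‖ ^ (l - j) := by
        rw [Complex.ofReal_mul, mul_assoc, Complex.ofReal_natCast, Complex.exp_nat_mul, norm_pow]
        exact pow_le_pow_of_le_one (norm_nonneg _)
          (norm_exp_mul_levyExponent_le_one v h.coe_nonneg _) hg
      calc _ ≤ 1 * ‖Complex.exp ((h : ℝ) * levyExponent v (-m.2))‖ ^ (l - j) * 1 := by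
            refine mul_le_mul (mul_le_mul (hle _) hgap (norm_nonneg _) zero_le_one) (hle _)
              (Finset.prod_nonneg fun _ _ => norm_nonneg _) (by positivity)
        _ = _ := by ring
  have hmain := ae_tendsto_sqAvg_zero (b := fun j ω => χ j ω - c) (C := 2)
    (fun j => (hχm j).sub aestronglyMeasurable_const)
    (fun j ω => (norm_sub_le _ _).trans (by
      rw [hχ1]
      linarith [norm_windowCharMean_le v h n m])) hρ0 hρ1 hcov
  filter_upwards [hmain] with ω hω
  have h1 := hω.add (tendsto_sqAvg_const c)
  rw [zero_add] at h1
  refine h1.congr fun N => ?_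
  rw [← sqAvg_add]
  simp [χ]

open Classical in
/-- Whether the `j`-th window of a trace shows the pattern `p`. -/
noncomputable def tracePattern (h : ℝ≥0) (n : Fin k → ℕ) (p : Finset ℕ) (g : ℝ≥0 → ℝ) (j : ℕ) : ℂ :=
  if ∀ i ≤ k, g (sampleTime h n j i) = 1 ↔ i ∈ p then 1 else 0

theorem tracePattern_indicator (h : ℝ≥0) (n : Fin k → ℕ) (p : Finset ℕ) (U : Set (Torus d))
    (x : ℝ≥0 → Torus d) (j : ℕ) :
    tracePattern h n p (fun t => U.indicator 1 (x t)) j =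
      (windowPattern U k p).indicator 1 (sampleWindow h n x j) := by
  classical
  have h1 : ∀ y : Torus d, U.indicator (1 : Torus d → ℝ) y = 1 ↔ y ∈ U := fun y => by
    by_cases hy : y ∈ U <;> simp [hy]
  have h2 : (∀ i ≤ k, U.indicator (1 : Torus d → ℝ) (x (sampleTime h n j i)) = 1 ↔ i ∈ p) ↔
      sampleWindow h n x j ∈ windowPattern U k p := by
    refine forall₂_congr fun i hi => ?_
    rw [h1, windowSite_sampleWindow h n x j hi]
  unfold tracePattern
  rw [Set.indicator_apply]
  exact if_congr h2 rfl rfl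

/-- Almost surely, for every open set with null boundary, the frequencies of all patterns along the
trace are given by its pattern integrals. -/
theorem IsTorusBrownianMotion.ae_tendsto_tracePattern [IsProbabilityMeasure P]
    (hX : IsTorusBrownianMotion v X P) {h : ℝ≥0} (hh : 0 < h) :
    ∀ᵐ ω ∂P, ∀ U : Set (Torus d), IsOpen U → volume (frontier U) = 0 →
      ∀ (k : ℕ) (n : Fin k → ℕ) (p : Finset ℕ),
        Tendsto (sqAvg (tracePattern h n p fun t => U.indicator 1 (X t ω))) atTop
          (𝓝 (patternIntegral U k p fun i => wrappedDensity v (((n i + 1 : ℕ) : ℝ) * h))) := by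
  -- Only countably many characters are involved, so one null set serves every `U`.
  have hall : ∀ᵐ ω ∂P, ∀ (k : ℕ) (n : Fin k → ℕ) (m : (Fin k → Fin d → ℤ) × (Fin d → ℤ)),
      Tendsto (sqAvg fun j => windowChar m (sampleWindow h n (fun t => X t ω) j)) atTop
        (𝓝 (windowCharMean v h n m)) :=
    ae_all_iff.2 fun k => ae_all_iff.2 fun n => ae_all_iff.2 fun m =>
      hX.ae_tendsto_windowChar hh n m
  filter_upwards [hall] with ω hω U hU hU0 k n p
  set w : C(Window d k, ℂ) :=
    incrementProd fun i => wrappedDensity v (((n i + 1 : ℕ) : ℝ) * h) with hw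
  let ℓ := integralMulCLM (windowHaar d k) w w.continuous.measurable fun x => w.norm_coe_le_norm x
  have hℓ : ∀ F, ℓ F = ∫ x, F x * w x ∂windowHaar d k := fun F => by
    change ∫ x, w x * F x ∂windowHaar d k = _
    simp only [mul_comm]
  have hcont : ∀ F : C(Window d k, ℂ), Tendsto
      (sqAvg fun j => F (sampleWindow h n (fun t => X t ω) j)) atTop
      (𝓝 (∫ x, F x * w x ∂windowHaar d k)) := by
    intro F
    rw [← hℓ]
    refine tendsto_sqAvg_of_span_dense _ ℓ span_windowChar_topologicalClosure_eq_top ?_ F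
    rintro _ ⟨m, rfl⟩
    rw [hℓ, hw, integral_windowChar_mul_wrappedDensity v fun i => by positivity]
    exact hω k n m
  have hind := tendsto_sqAvg_indicator (windowHaar d k) _ w hcont
    (measurableSet_windowPattern hU.measurableSet p) (windowHaar_frontier_windowPattern hU0 p)
  refine hind.congr fun N => ?_
  congr 1
  funext j
  exact (tracePattern_indicator h n p U (fun t => X t ω) j).symm

end BrownianMotion

/-! ### The reconstruction map. -/

theorem corollary1p4 {d : ℕ} {Ω : Type*} [MeasurableSpace Ω] (P : Measure Ω)
    [IsProbabilityMeasure P] (v : Fin d → ℝ) (hv : LinearIndependent ℚ v)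
    (X : ℝ≥0 → Ω → Torus d) (hX : IsTorusBrownianMotion v X P) :
    IsReconstructibleBy (openIndicators d) X P := by
  classical
  obtain ⟨h, hh, hinj⟩ := exists_injective_exp_mul_levyExponent hv
  -- `V` is a candidate if the frequencies it predicts are those observed in `g`; the map picks any
  -- candidate.
  let C : (ℝ≥0 → ℝ) → Set (Torus d) → Prop := fun g V =>
    IsOpen V ∧ volume (frontier V) = 0 ∧ ∀ (k : ℕ) (n : Fin k → ℕ) (p : Finset ℕ),
      Tendsto (sqAvg (tracePattern h n p g)) atTop
        (𝓝 (patternIntegral V k p fun i => wrappedDensity v (((n i + 1 : ℕ) : ℝ) * h)))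
  refine ⟨fun g => if H : ∃ V, C g V then H.choose.indicator 1 else 0, ?_⟩
  rintro _ ⟨U, hU, hU0, rfl⟩
  filter_upwards [hX.ae_tendsto_tracePattern hh] with ω hω
  have hCU : C (fun t => U.indicator 1 (X t ω)) U := ⟨hU, hU0, hω U hU hU0⟩
  have H : ∃ V, C (fun t => U.indicator 1 (X t ω)) V := ⟨U, hCU⟩
  obtain ⟨hV, hV0, hVC⟩ := H.choose_spec
  rw [dif_pos H]
  -- Both sets have the same observed limits, so uniqueness of limits equates their pattern
  -- integrals at grid lags. The chosen set comes first so that the shift falls on `U`.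
  exact exists_ae_indicator_eq_of_patternIntegral_eq hV hU hV0 hU0 fun k p =>
    patternIntegral_eq_of_wrappedDensity hh hinj hV.measurableSet hU.measurableSet p fun n =>
      tendsto_nhds_unique (hVC k n p) (hCU.2.2 k n p)
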